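/- Let $X_1,X_2,\dots$ be i.i.d. random variables with values in $\{1,2,\dots\}$, such that $p_i:=\mathbb P(X_1=i)>0$ and $p_i\ge p_{i+1}$ for all $i\ge1$. Let $\Pi=\{\Pi(t),t\ge0\}$ be a Poisson process with intensity $1$, independent of $(X_n)_{n\ge1}$, with arrival times $0<T_1<T_2<\cdots$ (almost surely), and let $\Pi(B)$ denote the number of arrival times in a Borel set $B\subseteq[0,\infty)$. For a Borel set $A\subseteq[0,1]$, $k\ge1$ and $t>0$ put $tA=\{ta:a\in A\}$ and let \[ R^{\Pi,*}_{tA,k}:=\sum_{i=1}^\infty \mathbf 1\bigl(\exists\,T_{n_1}<\dots<T_{n_k}\in tA:\ X_{n_1}=\dots=X_{n_k}=i\bigr) \] be the number of urns hit by at least $k$ balls thrown at arrival times in $tA$. Let $M(t):=\mathbb E R^{\Pi,*}_{t[0,1],1}$ and \[ Y^{\Pi,*}_{t,A,k}:=\frac{R^{\Pi,*}_{tA,k}-\mathbb E R^{\Pi,*}_{tA,k}}{\sqrt{M(t)}} . \] Assume the regularity condition: for some $\theta\in(0,1)$ and some function $L$ slowly varying at infinity, \[ \alpha(x):=\max\{i>0:\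 p_i\ge 1/x\}=x^\theta L(x)\quad\text{for all sufficiently large }x . \] Theorem (CLT for Poissonization). Let $m\ge1$, $k_1,\dots,k_m\ge1$, and let $A_1,\dots,A_m\subseteq[0,1]$ be Borel sets. All the expectations above are finite, the integrals \[ K^*(A_r,k_r,A_s,k_s):=\frac1{\Gamma(1-\theta)}\int_0^\infty \mathrm{cov}\bigl(\mathbf 1(\Pi(uA_r)<k_r),\mathbf 1(\Pi(uA_s)<k_s)\bigr)\,d(-u^{-\theta}), \] where $d(-u^{-\theta})=\theta u^{-\theta-1}\,du$, converge absolutely, and as $t\to\infty$ the random vectors \[ \bigl(Y^{\Pi,*}_{t,A_1,k_1},\dots,Y^{\Pi,*}_{t,A_m,k_m}\bigr) \] converge in distribution to a centered Gaussian vector $\bigl(Y^*_{A_1,k_1},\dots,Y^*_{A_m,k_m}\bigr)$ with covariances $\mathrm{cov}(Y^*_{A_r,k_r},Y^*_{A_s,k_s})=K^*(A_r,k_r,A_s,k_s)$ for all $r,s$. -/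

import Mathlib

open MeasureTheory ProbabilityTheory Filter Topology Set
open scoped NNReal

/-- `N` is a (homogeneous) Poisson process of intensity `1` on `[0, ∞)`: it starts at `0`, its paths
are nondecreasing and right-continuous (almost surely), its increments are independent, and the
increment over `(s, t]` has the Poisson law with parameter `t - s`. (The differences are taken in
`ℕ`, where they are not truncated because the paths are nondecreasing.) -/
structure IsUnitPoissonProcess {Ω : Type*} [MeasurableSpace Ω] (N : ℝ≥0 → Ω → ℕ)
    (P : Measure Ω) : Prop where
  measurable : ∀ t, Measurable (N t)
  paths : ∀ᵐ ω ∂P, N 0 ω = 0 ∧ Monotone (fun t => N t ω) ∧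
    ∀ t, ContinuousWithinAt (fun s => N s ω) (Ici t) t
  indep_increments : HasIndepIncrements N P
  law_increments : ∀ s t : ℝ≥0, s ≤ t →
    HasLaw (fun ω => N t ω - N s ω) (poissonMeasure (t - s)) P

/-- `L` is slowly varying at infinity. -/
structure IsSlowlyVarying (L : ℝ → ℝ) : Prop where
  measurable : Measurable L
  eventually_pos : ∀ᶠ x in atTop, 0 < L x
  tendsto_ratio : ∀ c : ℝ, 0 < c → Tendsto (fun x => L (c * x) / L x) atTop (𝓝 1)

namespace UrnScheme

noncomputable section

variable {Ω : Type*} [MeasurableSpace Ω]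

/-- The `n`-th arrival time `T_n` (`n ≥ 1`) of the counting process `N`. -/
def arrivalTime (N : ℝ≥0 → Ω → ℕ) (n : ℕ) (ω : Ω) : ℝ :=
  ((sInf {s : ℝ≥0 | n ≤ N s ω} : ℝ≥0) : ℝ)

/-- The number `N(B)` of arrival times lying in `B`. -/
def numPoints (N : ℝ≥0 → Ω → ℕ) (B : Set ℝ) (ω : Ω) : ℕ∞ :=
  {n : ℕ | 1 ≤ n ∧ arrivalTime N n ω ∈ B}.encard

/-- The dilated set `tA = {ta : a ∈ A}`. -/
def dilate (t : ℝ) (A : Set ℝ) : Set ℝ := (fun a => t * a) '' A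

/-- The set of urns `i ≥ 1` which are hit by at least `k` balls thrown at arrival times in `B`:
the ball `n ≥ 1` is thrown at time `T_n` into the urn `X n`. -/
def hitUrns (X : ℕ → Ω → ℕ) (N : ℝ≥0 → Ω → ℕ) (B : Set ℝ) (k : ℕ) (ω : Ω) : Set ℕ :=
  {i | 1 ≤ i ∧ ∃ n : Fin k → ℕ, (∀ j, 1 ≤ n j) ∧
    StrictMono (fun j => arrivalTime N (n j) ω) ∧
    ∀ j, arrivalTime N (n j) ω ∈ B ∧ X (n j) ω = i}

/-- The Poissonized statistic `R^{Π,*}_{tA,k}`, the number of urns hit by at least `k` balls thrown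
at arrival times in `tA`. -/
def R (X : ℕ → Ω → ℕ) (N : ℝ≥0 → Ω → ℕ) (t : ℝ) (A : Set ℝ) (k : ℕ) (ω : Ω) : ℝ :=
  ((hitUrns X N (dilate t A) k ω).ncard : ℝ)

/-- `M(t)`, the expected number of nonempty urns at time `t`. -/
def M (X : ℕ → Ω → ℕ) (N : ℝ≥0 → Ω → ℕ) (P : Measure Ω) (t : ℝ) : ℝ :=
  ∫ ω, R X N t (Icc 0 1) 1 ω ∂P

/-- The centered and normalized statistic `Y^{Π,*}_{t,A,k}`. -/
def Y (X : ℕ → Ω → ℕ) (N : ℝ≥0 → Ω → ℕ) (P : Measure Ω) (t : ℝ) (A : Set ℝ) (k : ℕ)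
    (ω : Ω) : ℝ :=
  (R X N t A k ω - ∫ ω', R X N t A k ω' ∂P) / √(M X N P t)

/-- `α(x) = max {i > 0 : p i ≥ 1 / x}`. -/
def countingFunction (p : ℕ → ℝ) (x : ℝ) : ℕ := sSup {i : ℕ | 0 < i ∧ 1 / x ≤ p i}

/-- The regularity condition `α(x) = x ^ θ * L(x)` (for large `x`) with `L` slowly varying. -/
def RegularityCondition (p : ℕ → ℝ) (θ : ℝ) : Prop :=
  ∃ L : ℝ → ℝ, IsSlowlyVarying L ∧ ∀ᶠ x : ℝ in atTop, (countingFunction p x : ℝ) = x ^ θ * L x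

/-- The integrand `cov (1(N(uA₁) < k₁), 1(N(uA₂) < k₂)) * (θ u ^ (-θ - 1))`, where
`θ u ^ (-θ - 1) du = d(-u ^ (-θ))`. -/
def covIntegrand (N : ℝ≥0 → Ω → ℕ) (P : Measure Ω) (θ : ℝ) (A₁ : Set ℝ) (k₁ : ℕ) (A₂ : Set ℝ)
    (k₂ : ℕ) (u : ℝ) : ℝ :=
  cov[{ω | numPoints N (dilate u A₁) ω < k₁}.indicator (fun _ => (1 : ℝ)),
      {ω | numPoints N (dilate u A₂) ω < k₂}.indicator (fun _ => (1 : ℝ)); P]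
    * (θ * u ^ (-θ - 1))

/-- The limiting covariance `K^*(A₁, k₁, A₂, k₂)`. -/
def Kstar (N : ℝ≥0 → Ω → ℕ) (P : Measure Ω) (θ : ℝ) (A₁ : Set ℝ) (k₁ : ℕ) (A₂ : Set ℝ)
    (k₂ : ℕ) : ℝ :=
  1 / Real.Gamma (1 - θ) * ∫ u in Ioi (0 : ℝ), covIntegrand N P θ A₁ k₁ A₂ k₂ u

end

end UrnScheme

namespace UrnScheme

/-! ### Functions with integrable derivative -/

/-- `f` is continuously differentiable, `f` and its derivative are bounded on `[0, ∞)`, and the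
derivative is integrable on `(0, ∞)`. -/
structure IsTame (f : ℝ → ℝ) : Prop where
  contDiff : ContDiff ℝ 1 f
  bound : ∃ C : ℝ, ∀ u, 0 ≤ u → |f u| ≤ C ∧ |deriv f u| ≤ C
  integrable : IntegrableOn (deriv f) (Ioi 0)

namespace IsTame

variable {f g : ℝ → ℝ}

lemma differentiable (hf : IsTame f) : Differentiable ℝ f :=
  hf.contDiff.differentiable (by norm_num)

lemma continuous_deriv (hf : IsTame f) : Continuous (deriv f) :=
  hf.contDiff.continuous_deriv le_rfl

lemma const (c : ℝ) : IsTame (fun _ => c) where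
  contDiff := contDiff_const
  bound := ⟨|c|, by simp⟩
  integrable := by simp [deriv_const']

lemma add (hf : IsTame f) (hg : IsTame g) : IsTame (fun u => f u + g u) := by
  have hd : deriv (fun u => f u + g u) = fun u => deriv f u + deriv g u :=
    funext fun u => deriv_fun_add (hf.differentiable u) (hg.differentiable u)
  obtain ⟨C, hC⟩ := hf.bound
  obtain ⟨D, hD⟩ := hg.bound
  refine ⟨hf.contDiff.add hg.contDiff, ⟨C + D, fun u hu => ?_⟩, ?_⟩
  · rw [hd]
    exact ⟨(abs_add_le _ _).trans (add_le_add (hC u hu).1 (hD u hu).1),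
      (abs_add_le _ _).trans (add_le_add (hC u hu).2 (hD u hu).2)⟩
  · rw [hd]
    exact hf.integrable.add hg.integrable

lemma mul (hf : IsTame f) (hg : IsTame g) : IsTame (fun u => f u * g u) := by
  have hd : deriv (fun u => f u * g u) = fun u => deriv f u * g u + f u * deriv g u :=
    funext fun u => deriv_fun_mul (hf.differentiable u) (hg.differentiable u)
  obtain ⟨C, hC⟩ := hf.bound
  obtain ⟨D, hD⟩ := hg.bound
  have hC0 : 0 ≤ C := (abs_nonneg _).trans (hC 0 le_rfl).1
  have hD0 : 0 ≤ D := (abs_nonneg _).trans (hD 0 le_rfl).1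
  refine ⟨hf.contDiff.mul hg.contDiff, ⟨C * D + C * D, fun u hu => ⟨?_, ?_⟩⟩, ?_⟩
  · rw [abs_mul]
    have := mul_le_mul (hC u hu).1 (hD u hu).1 (abs_nonneg _) hC0
    have := mul_nonneg hC0 hD0
    linarith
  · rw [hd]
    refine (abs_add_le _ _).trans (add_le_add ?_ ?_) <;> rw [abs_mul]
    · exact mul_le_mul (hC u hu).2 (hD u hu).1 (abs_nonneg _) hC0
    · exact mul_le_mul (hC u hu).1 (hD u hu).2 (abs_nonneg _) hC0
  · rw [hd]
    have hae : ∀ᵐ u ∂(volume.restrict (Ioi (0 : ℝ))), 0 < u := ae_restrict_mem measurableSet_Ioi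
    refine IntegrableOn.add ?_ ?_
    · refine Integrable.mul_bdd (c := D) hf.integrable
        hg.differentiable.continuous.aestronglyMeasurable ?_
      filter_upwards [hae] with u hu using (hD u hu.le).1
    · refine Integrable.bdd_mul (c := C) hg.integrable
        hf.differentiable.continuous.aestronglyMeasurable ?_
      filter_upwards [hae] with u hu using (hC u hu.le).1

lemma sub (hf : IsTame f) (hg : IsTame g) : IsTame (fun u => f u - g u) := by
  simpa [sub_eq_add_neg] using hf.add ((const (-1)).mul hg)

lemma sum {ι : Type*} (s : Finset ι) {F : ι → ℝ → ℝ} (hF : ∀ i ∈ s, IsTame (F i)) :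
    IsTame (fun u => ∑ i ∈ s, F i u) := by
  classical
  induction s using Finset.induction_on with
  | empty => simpa using const 0
  | insert i s hi ih =>
    simp only [Finset.sum_insert hi]
    exact (hF i (by simp)).add (ih fun j hj => hF j (by simp [hj]))

lemma comp_mul_left (hf : IsTame f) {a : ℝ} (ha : 0 ≤ a) : IsTame (fun u => f (a * u)) := by
  have hd : deriv (fun u => f (a * u)) = fun u => a * deriv f (a * u) := by
    funext u
    simpa using deriv_comp_mul_left a f u
  obtain ⟨C, hC⟩ := hf.bound
  have hC0 : 0 ≤ C := (abs_nonneg _).trans (hC 0 le_rfl).1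
  refine ⟨hf.contDiff.comp (contDiff_const.mul contDiff_id), ⟨C + a * C, fun u hu => ⟨?_, ?_⟩⟩, ?_⟩
  · have := (hC (a * u) (by positivity)).1
    have : 0 ≤ a * C := by positivity
    linarith
  · rw [hd, abs_mul, abs_of_nonneg ha]
    have := mul_le_mul_of_nonneg_left (hC (a * u) (by positivity)).2 ha
    linarith
  · rw [hd]
    rcases ha.eq_or_lt with rfl | ha
    · simp
    · refine Integrable.const_mul ?_ a
      have := (integrableOn_Ioi_comp_mul_left_iff (deriv f) 0 ha).2 (by simpa using hf.integrable)
      simpa [IntegrableOn] using this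

/-- A tame function vanishing at `0` is bounded by a constant multiple of `u`. -/
lemma exists_abs_le_mul (hf : IsTame f) (h0 : f 0 = 0) : ∃ C, 0 ≤ C ∧ ∀ u, 0 ≤ u →
    |f u| ≤ C ∧ |f u| ≤ C * u ∧ |deriv f u| ≤ C := by
  obtain ⟨C, hC⟩ := hf.bound
  refine ⟨C, (abs_nonneg _).trans (hC 0 le_rfl).1, fun u hu => ⟨(hC u hu).1, ?_, (hC u hu).2⟩⟩
  have := Convex.norm_image_sub_le_of_norm_deriv_le (f := f) (s := Ici (0 : ℝ)) (x := 0) (y := u)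
    (C := C) (fun x _ => hf.differentiable x) (fun x hx => (hC x hx).2) (convex_Ici 0)
    self_mem_Ici hu
  simpa [h0, abs_of_nonneg hu] using this

end IsTame

/-- The Poisson weight `e^{-x} x^j / j!`. -/
noncomputable def poissonWeight (j : ℕ) (x : ℝ) : ℝ := Real.exp (-x) * x ^ j / j.factorial

lemma poissonWeight_nonneg (j : ℕ) {x : ℝ} (hx : 0 ≤ x) : 0 ≤ poissonWeight j x := by
  unfold poissonWeight; positivity

lemma poissonWeight_le_one (j : ℕ) {x : ℝ} (hx : 0 ≤ x) : poissonWeight j x ≤ 1 := by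
  have h := Real.pow_div_factorial_le_exp x hx j
  calc poissonWeight j x = Real.exp (-x) * (x ^ j / j.factorial) := by
        unfold poissonWeight; ring
    _ ≤ Real.exp (-x) * Real.exp x := by gcongr
    _ = 1 := by rw [← Real.exp_add]; simp

lemma integrableOn_poissonWeight (j : ℕ) : IntegrableOn (poissonWeight j) (Ioi 0) := by
  have h := (Real.GammaIntegral_convergent (s := (j : ℝ) + 1) (by positivity)).div_const
    (j.factorial : ℝ)
  refine h.congr (ae_of_all _ fun x => ?_)
  simp [poissonWeight]

lemma hasDerivAt_poissonWeight_zero (x : ℝ) :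
    HasDerivAt (poissonWeight 0) (-poissonWeight 0 x) x := by
  have h : HasDerivAt (fun x : ℝ => Real.exp (-x)) (-Real.exp (-x)) x := by
    simpa using (hasDerivAt_neg x).exp
  convert! h using 1
  · funext y; simp [poissonWeight]
  · simp [poissonWeight]

lemma hasDerivAt_poissonWeight_succ (j : ℕ) (x : ℝ) :
    HasDerivAt (poissonWeight (j + 1)) (poissonWeight j x - poissonWeight (j + 1) x) x := by
  have h : HasDerivAt (fun x : ℝ => Real.exp (-x)) (-Real.exp (-x)) x := by
    simpa using (hasDerivAt_neg x).exp
  have h2 := (h.mul (hasDerivAt_pow (j + 1) x)).div_const ((j + 1).factorial : ℝ)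
  convert! h2 using 1
  simp only [poissonWeight, Nat.factorial_succ]
  push_cast
  have : (j.factorial : ℝ) ≠ 0 := by positivity
  field_simp
  ring

lemma isTame_poissonWeight (j : ℕ) : IsTame (poissonWeight j) := by
  refine ⟨?_, ⟨2, fun u hu => ?_⟩, ?_⟩
  · unfold poissonWeight; fun_prop
  · have h1 := poissonWeight_nonneg j hu
    have h2 := poissonWeight_le_one j hu
    refine ⟨abs_le.2 ⟨by linarith, by linarith⟩, ?_⟩
    cases j with
    | zero =>
      rw [(hasDerivAt_poissonWeight_zero u).deriv]
      exact abs_le.2 ⟨by linarith, by linarith⟩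
    | succ j =>
      rw [(hasDerivAt_poissonWeight_succ j u).deriv]
      have h3 := poissonWeight_nonneg j hu
      have h4 := poissonWeight_le_one j hu
      exact abs_le.2 ⟨by linarith, by linarith⟩
  · cases j with
    | zero =>
      rw [show deriv (poissonWeight 0) = fun u => -poissonWeight 0 u from
        funext fun u => (hasDerivAt_poissonWeight_zero u).deriv]
      exact (integrableOn_poissonWeight 0).neg
    | succ j =>
      rw [show deriv (poissonWeight (j + 1)) = fun u => poissonWeight j u - poissonWeight (j + 1) u
        from funext fun u => (hasDerivAt_poissonWeight_succ j u).deriv]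
      exact (integrableOn_poissonWeight j).sub (integrableOn_poissonWeight (j + 1))

/-! ### Integration against `d(-u^{-θ})` -/

section Integral

variable {f : ℝ → ℝ} {θ : ℝ}

lemma IsTame.integrableOn_mul_rpow (hf : IsTame f) (h0 : f 0 = 0) (hθ : θ ∈ Ioo (0 : ℝ) 1) :
    IntegrableOn (fun u => f u * (θ * u ^ (-θ - 1))) (Ioi 0) := by
  obtain ⟨C, hC0, hC⟩ := hf.exists_abs_le_mul h0
  have hmeas : Measurable (fun u => f u * (θ * u ^ (-θ - 1))) :=
    hf.differentiable.continuous.measurable.mul (by fun_prop)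
  rw [← Ioc_union_Ioi_eq_Ioi (zero_le_one' ℝ)]
  refine IntegrableOn.union ?_ ?_
  · have h1 : IntegrableOn (fun u : ℝ => C * θ * u ^ (-θ)) (Ioc 0 1) := by
      refine Integrable.const_mul ?_ _
      rw [← IntegrableOn, integrableOn_Ioc_iff_integrableOn_Ioo]
      exact (intervalIntegral.integrableOn_Ioo_rpow_iff one_pos).2 (by linarith [hθ.2])
    refine h1.mono' hmeas.aestronglyMeasurable ?_
    filter_upwards [ae_restrict_mem measurableSet_Ioc] with u hu
    have hu0 : 0 < u := hu.1
    have e : u ^ (-θ) = u * u ^ (-θ - 1) := by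
      rw [← Real.rpow_one_add' hu0.le (by linarith [hθ.1])]; ring_nf
    rw [Real.norm_eq_abs, abs_mul, abs_of_nonneg (a := θ * _) (mul_nonneg hθ.1.le (by positivity)),
      e]
    have hp : 0 ≤ θ * u ^ (-θ - 1) := mul_nonneg hθ.1.le (by positivity)
    calc |f u| * (θ * u ^ (-θ - 1)) ≤ (C * u) * (θ * u ^ (-θ - 1)) :=
          mul_le_mul_of_nonneg_right (hC u hu0.le).2.1 hp
      _ = _ := by ring
  · have h1 : IntegrableOn (fun u : ℝ => C * (θ * u ^ (-θ - 1))) (Ioi 1) :=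
      (((integrableOn_Ioi_rpow_iff one_pos).2 (by linarith [hθ.1])).const_mul θ).const_mul C
    refine h1.mono' hmeas.aestronglyMeasurable ?_
    filter_upwards [ae_restrict_mem measurableSet_Ioi] with u hu
    have hu0 : 0 < u := one_pos.trans hu
    have hp : 0 ≤ θ * u ^ (-θ - 1) := mul_nonneg hθ.1.le (by positivity)
    rw [Real.norm_eq_abs, abs_mul, abs_of_nonneg hp]
    exact mul_le_mul_of_nonneg_right (hC u hu0.le).1 hp

lemma IsTame.integrableOn_deriv_mul_rpow (hf : IsTame f) {ρ : ℝ} (hρ : ρ ∈ Ioo (0 : ℝ) 1) :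
    IntegrableOn (fun u => deriv f u * u ^ (-ρ)) (Ioi 0) := by
  obtain ⟨C, hC⟩ := hf.bound
  have hmeas : Measurable (fun u => deriv f u * u ^ (-ρ)) :=
    hf.continuous_deriv.measurable.mul (by fun_prop)
  rw [← Ioc_union_Ioi_eq_Ioi (zero_le_one' ℝ)]
  refine IntegrableOn.union ?_ ?_
  · have h1 : IntegrableOn (fun u : ℝ => C * u ^ (-ρ)) (Ioc 0 1) := by
      refine Integrable.const_mul ?_ _
      rw [← IntegrableOn, integrableOn_Ioc_iff_integrableOn_Ioo]
      exact (intervalIntegral.integrableOn_Ioo_rpow_iff one_pos).2 (by linarith [hρ.2])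
    refine h1.mono' hmeas.aestronglyMeasurable ?_
    filter_upwards [ae_restrict_mem measurableSet_Ioc] with u hu
    have hu0 : 0 < u := hu.1
    rw [Real.norm_eq_abs, abs_mul, abs_of_nonneg (a := u ^ _) (by positivity)]
    exact mul_le_mul_of_nonneg_right (hC u hu0.le).2 (by positivity)
  · refine (hf.integrable.mono_set (Ioi_subset_Ioi zero_le_one)).norm.mono'
      hmeas.aestronglyMeasurable ?_
    filter_upwards [ae_restrict_mem measurableSet_Ioi] with u hu
    have hu0 : 0 < u := one_pos.trans hu
    rw [Real.norm_eq_abs, abs_mul, abs_of_nonneg (a := u ^ _) (by positivity), Real.norm_eq_abs]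
    exact mul_le_of_le_one_right (abs_nonneg _)
      (Real.rpow_le_one_of_one_le_of_nonpos (le_of_lt hu) (by linarith [hρ.1]))

lemma IsTame.integral_mul_rpow (hf : IsTame f) (h0 : f 0 = 0) (hθ : θ ∈ Ioo (0 : ℝ) 1) :
    ∫ u in Ioi (0 : ℝ), f u * (θ * u ^ (-θ - 1)) = ∫ u in Ioi (0 : ℝ), deriv f u * u ^ (-θ) := by
  obtain ⟨C, hC0, hC⟩ := hf.exists_abs_le_mul h0
  have hv : ∀ x ∈ Ioi (0 : ℝ), HasDerivAt (fun u : ℝ => -u ^ (-θ)) (θ * x ^ (-θ - 1)) x := by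
    intro x hx
    have := (Real.hasDerivAt_rpow_const (p := -θ) (Or.inl (ne_of_gt hx))).fun_neg
    simpa using this
  have h := integral_Ioi_mul_deriv_eq_deriv_mul (a := 0) (a' := 0) (b' := 0) (u := f)
    (v := fun u => -u ^ (-θ)) (u' := deriv f) (v' := fun x => θ * x ^ (-θ - 1))
    (fun x _ => (hf.differentiable x).hasDerivAt) hv (hf.integrableOn_mul_rpow h0 hθ)
    (by
      have := (hf.integrableOn_deriv_mul_rpow hθ).neg
      refine this.congr (ae_of_all _ fun x => ?_)
      simp) ?_ ?_
  · simp only [h, mul_neg, integral_neg]; ring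
  · refine squeeze_zero_norm' (a := fun u : ℝ => C * u ^ (1 - θ)) ?_ ?_
    · filter_upwards [self_mem_nhdsWithin] with u hu
      have hu0 : (0 : ℝ) < u := hu
      have e : u ^ (1 - θ) = u * u ^ (-θ) := by
        rw [← Real.rpow_one_add' hu0.le (by linarith [hθ.2])]; ring_nf
      rw [Pi.mul_apply, Real.norm_eq_abs, abs_mul, abs_neg, abs_of_nonneg (a := u ^ _)
        (by positivity), e, ← mul_assoc]
      exact mul_le_mul_of_nonneg_right (hC u hu0.le).2.1 (by positivity)
    · have : Tendsto (fun u : ℝ => C * u ^ (1 - θ)) (𝓝 0) (𝓝 (C * 0 ^ (1 - θ))) :=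
        ((Real.continuousAt_rpow_const 0 (1 - θ) (Or.inr (by linarith [hθ.2]))).tendsto).const_mul C
      rw [Real.zero_rpow (by linarith [hθ.2]), mul_zero] at this
      exact this.mono_left nhdsWithin_le_nhds
  · refine squeeze_zero_norm' (a := fun u : ℝ => C * u ^ (-θ)) ?_ ?_
    · filter_upwards [eventually_gt_atTop 0] with u hu0
      rw [Pi.mul_apply, Real.norm_eq_abs, abs_mul, abs_neg, abs_of_nonneg (a := u ^ _)
        (by positivity)]
      exact mul_le_mul_of_nonneg_right (hC u hu0.le).1 (by positivity)
    · simpa using (tendsto_rpow_neg_atTop hθ.1).const_mul C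

end Integral

end UrnScheme

namespace UrnScheme

/-! ### Regular variation -/

/-- A Potter-type bound for monotone functions of regular variation. -/
lemma exists_potter_bound {a : ℝ → ℝ} {θ : ℝ} (ha : Monotone a) (hθ : θ ∈ Ioo (0 : ℝ) 1)
    (hpos : ∀ᶠ x in atTop, 0 < a x)
    (hratio : ∀ c : ℝ, 0 < c → Tendsto (fun x => a (c * x) / a x) atTop (𝓝 (c ^ θ))) :
    ∃ ρ ∈ Ioo (0 : ℝ) 1, ∃ C : ℝ, ∀ᶠ x in atTop, ∀ v ∈ Ioc (0 : ℝ) 1,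
      a (x / v) / a x ≤ C * v ^ (-ρ) := by
  set ρ := (θ + 1) / 2 with hρ
  have hρ0 : 0 < ρ := by linarith [hθ.1]
  refine ⟨ρ, ⟨hρ0, by linarith [hθ.2]⟩, 2 ^ ρ, ?_⟩
  have h2 : ∀ᶠ x in atTop, a (2 * x) / a x < 2 ^ ρ :=
    (hratio 2 two_pos).eventually_lt_const
      (Real.rpow_lt_rpow_of_exponent_lt one_lt_two (by linarith [hθ.2]))
  obtain ⟨x₀, hx₀⟩ := eventually_atTop.1 (h2.and hpos)
  have key : ∀ j : ℕ, ∀ x, max x₀ 1 ≤ x → a (2 ^ j * x) ≤ (2 ^ ρ) ^ j * a x := by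
    intro j
    induction j with
    | zero => intro x _; simp
    | succ j ih =>
      intro x hx
      have hx1 : 1 ≤ x := (le_max_right _ _).trans hx
      have hle : x ≤ 2 ^ j * x := le_mul_of_one_le_left (by linarith) (one_le_pow₀ one_le_two)
      obtain ⟨h3, h4⟩ := hx₀ (2 ^ j * x) (((le_max_left _ _).trans hx).trans hle)
      rw [div_lt_iff₀ h4] at h3
      calc a (2 ^ (j + 1) * x) = a (2 * (2 ^ j * x)) := by ring_nf
        _ ≤ 2 ^ ρ * a (2 ^ j * x) := h3.le
        _ ≤ 2 ^ ρ * ((2 ^ ρ) ^ j * a x) := by gcongr; exact ih x hx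
        _ = _ := by ring
  filter_upwards [eventually_ge_atTop (max x₀ 1)] with x hx v hv
  have hax : 0 < a x := (hx₀ x ((le_max_left _ _).trans hx)).2
  have hx1 : 1 ≤ x := (le_max_right _ _).trans hx
  obtain ⟨n, hn1, hn2⟩ := exists_nat_pow_near (x := 1 / v) (y := 2)
    (by rw [le_div_iff₀ hv.1]; linarith [hv.2]) one_lt_two
  rw [div_le_iff₀ hax]
  calc a (x / v) ≤ a (2 ^ (n + 1) * x) := by
        apply ha
        rw [div_eq_mul_one_div, mul_comm]
        exact mul_le_mul_of_nonneg_right hn2.le (by linarith)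
    _ ≤ (2 ^ ρ) ^ (n + 1) * a x := key _ x hx
    _ ≤ _ := by
        gcongr
        rw [pow_succ, mul_comm]
        gcongr
        rw [← Real.rpow_natCast, ← Real.rpow_mul two_pos.le, mul_comm, Real.rpow_mul two_pos.le,
          Real.rpow_natCast]
        calc ((2 : ℝ) ^ n) ^ ρ ≤ (1 / v) ^ ρ := by gcongr
          _ = v ^ (-ρ) := by rw [one_div, Real.inv_rpow hv.1.le, Real.rpow_neg hv.1.le]

section Frequencies

variable {p : ℕ → ℝ}

lemma antitone_frequencies (hp_anti : ∀ i, 1 ≤ i → p (i + 1) ≤ p i) :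
    Antitone (fun i => p (i + 1)) :=
  antitone_nat_of_succ_le fun i => hp_anti (i + 1) (by omega)

variable (hp_anti : ∀ i, 1 ≤ i → p (i + 1) ≤ p i) (hp_pos : ∀ i, 1 ≤ i → 0 < p i)
  (hp_sum : Summable (fun i => p (i + 1)))
include hp_anti hp_pos hp_sum

omit hp_anti hp_pos in
lemma bddAbove_frequencies_ge {x : ℝ} (hx : 0 < x) : BddAbove {i : ℕ | 0 < i ∧ 1 / x ≤ p i} := by
  have h : ∀ᶠ i in atTop, p (i + 1) < 1 / x :=
    hp_sum.tendsto_atTop_zero.eventually_lt_const (by positivity)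
  obtain ⟨n, hn⟩ := eventually_atTop.1 h
  refine ⟨n, fun i hi => ?_⟩
  by_contra hlt
  have := hn (i - 1) (by omega)
  rw [Nat.sub_add_cancel hi.1] at this
  linarith [hi.2]

omit hp_pos in
lemma lt_countingFunction_iff {x : ℝ} (hx : 0 < x) (i : ℕ) :
    i < countingFunction p x ↔ 1 / x ≤ p (i + 1) := by
  have hb := bddAbove_frequencies_ge hp_sum hx
  constructor
  · intro hi
    have hne : {i : ℕ | 0 < i ∧ 1 / x ≤ p i}.Nonempty := by
      by_contra hne
      rw [not_nonempty_iff_eq_empty] at hne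
      rw [countingFunction, hne] at hi
      simp at hi
    obtain ⟨h0, h1⟩ := Nat.sSup_mem hne hb
    refine h1.trans ?_
    have := antitone_frequencies hp_anti (show i ≤ countingFunction p x - 1 by omega)
    simp only [Nat.sub_add_cancel (show 1 ≤ countingFunction p x by omega)] at this
    exact this
  · intro hi
    exact Nat.lt_of_succ_le (le_csSup hb ⟨by omega, hi⟩)

lemma monotone_countingFunction : Monotone (countingFunction p) := by
  intro x y hxy
  by_cases hx : 0 < x
  · refine le_of_forall_lt fun i hi => ?_
    rw [lt_countingFunction_iff hp_anti hp_sum (hx.trans_le hxy)]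
    rw [lt_countingFunction_iff hp_anti hp_sum hx] at hi
    exact (one_div_le_one_div_of_le hx hxy).trans hi
  · have : countingFunction p x = 0 := by
      rw [countingFunction]
      refine Nat.sSup_of_not_bddAbove ?_
      rw [not_bddAbove_iff]
      refine fun n => ⟨n + 1, ⟨by omega, ?_⟩, by omega⟩
      exact (one_div_nonpos.2 (not_lt.1 hx)).trans (hp_pos (n + 1) (by omega)).le
    omega

lemma tendsto_countingFunction : Tendsto (fun x => (countingFunction p x : ℝ)) atTop atTop := by
  refine tendsto_natCast_atTop_atTop.comp (tendsto_atTop_atTop.2 fun n => ?_)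
  refine ⟨1 / p (n + 1), fun x hx => ?_⟩
  have h0 := hp_pos (n + 1) (by omega)
  have hx0 : 0 < x := (by positivity : 0 < 1 / p (n + 1)).trans_le hx
  refine ((lt_countingFunction_iff hp_anti hp_sum hx0 n).2 ?_).le
  rw [div_le_iff₀ hx0]
  rwa [div_le_iff₀ h0, mul_comm] at hx

omit hp_pos in
lemma tsum_indicator_frequencies {t v : ℝ} (ht : 0 < t) (hv : 0 < v) (c : ℝ) :
    ∑' i, (Iic (p (i + 1) * t)).indicator (fun _ => c) v = c * countingFunction p (t / v) := by
  have hiff : ∀ i, v ∈ Iic (p (i + 1) * t) ↔ i ∈ Finset.range (countingFunction p (t / v)) := by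
    intro i
    rw [Finset.mem_range, lt_countingFunction_iff hp_anti hp_sum (by positivity), mem_Iic,
      one_div_div, div_le_iff₀ ht]
  rw [tsum_eq_sum (s := Finset.range (countingFunction p (t / v)))]
  · rw [Finset.sum_congr rfl fun i hi => indicator_of_mem ((hiff i).2 hi) _]
    simp [mul_comm]
  · intro i hi
    exact indicator_of_notMem (fun h => hi ((hiff i).1 h)) _

/-- Summation by parts: `∑ f(p_i t) = ∫ f'(v) α(t / v) dv`. -/
lemma hasSum_tame_frequencies {f : ℝ → ℝ} (hf : IsTame f) (h0 : f 0 = 0) {t : ℝ} (ht : 0 < t) :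
    HasSum (fun i => f (p (i + 1) * t))
      (∫ v in Ioi (0 : ℝ), deriv f v * countingFunction p (t / v)) := by
  obtain ⟨C, hC0, hC⟩ := hf.exists_abs_le_mul h0
  have hq : ∀ i, 0 < p (i + 1) * t := fun i => mul_pos (hp_pos _ (by omega)) ht
  have hset : ∀ i, Ioi (0 : ℝ) ∩ Iic (p (i + 1) * t) = Ioc 0 (p (i + 1) * t) := fun i => rfl
  have hint : ∀ i, Integrable ((Iic (p (i + 1) * t)).indicator (deriv f))
      (volume.restrict (Ioi 0)) := fun i => hf.integrable.indicator measurableSet_Iic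
  have hval : ∀ i, ∫ v in Ioi (0 : ℝ), (Iic (p (i + 1) * t)).indicator (deriv f) v
      = f (p (i + 1) * t) := by
    intro i
    rw [setIntegral_indicator measurableSet_Iic, hset,
      ← intervalIntegral.integral_of_le (hq i).le,
      intervalIntegral.integral_deriv_eq_sub (fun x _ => hf.differentiable x)
        (hf.continuous_deriv.intervalIntegrable _ _), h0, sub_zero]
  have hnorm : ∀ i, ∫ v in Ioi (0 : ℝ), ‖(Iic (p (i + 1) * t)).indicator (deriv f) v‖
      ≤ C * (p (i + 1) * t) := by
    intro i
    simp_rw [norm_indicator_eq_indicator_norm]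
    rw [setIntegral_indicator measurableSet_Iic, hset]
    have h := norm_setIntegral_le_of_norm_le_const (μ := volume) (s := Ioc (0 : ℝ) (p (i + 1) * t))
      (f := fun v => ‖deriv f v‖) (C := C) (by simp) (fun v hv => by
        simpa using (hC v hv.1.le).2.2)
    refine (le_abs_self _).trans (h.trans (le_of_eq ?_))
    simp [measureReal_def, (hq i).le]
  have h := hasSum_integral_of_summable_integral_norm (μ := volume.restrict (Ioi (0 : ℝ))) hint
    (Summable.of_nonneg_of_le (fun i => integral_nonneg fun v => norm_nonneg _) hnorm
      ((hp_sum.mul_right t).mul_left C))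
  simp_rw [hval] at h
  suffices e : ∫ v in Ioi (0 : ℝ), deriv f v * countingFunction p (t / v) = ∫ v in Ioi (0 : ℝ),
      ∑' i, (Iic (p (i + 1) * t)).indicator (deriv f) v by rwa [e]
  refine setIntegral_congr_fun measurableSet_Ioi fun v hv => ?_
  rw [← tsum_indicator_frequencies hp_anti hp_sum ht hv (deriv f v)]
  refine tsum_congr fun i => ?_
  simp only [indicator_apply]

omit hp_anti hp_pos hp_sum in
lemma tendsto_countingFunction_ratio {θ : ℝ} (hreg : RegularityCondition p θ) {c : ℝ}
    (hc : 0 < c) : Tendsto (fun x => (countingFunction p (c * x) : ℝ) / countingFunction p x)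
      atTop (𝓝 (c ^ θ)) := by
  obtain ⟨L, hL, hα⟩ := hreg
  have hcx : Tendsto (fun x : ℝ => c * x) atTop atTop := tendsto_id.const_mul_atTop hc
  have h := (hL.tendsto_ratio c hc).const_mul (c ^ θ)
  rw [mul_one] at h
  refine h.congr' ?_
  filter_upwards [hα, hcx.eventually hα, eventually_gt_atTop 0] with x h1 h2 hx
  rw [h1, h2, Real.mul_rpow hc.le hx.le, mul_div_mul_comm, mul_div_assoc,
    div_self (Real.rpow_pos_of_pos hx θ).ne', mul_one]

/-- Karamata-type limit: `∑ f(p_i t) ∼ α(t) ∫ f(u) d(-u^{-θ})`. -/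
lemma tendsto_tsum_tame_frequencies {θ : ℝ} (hθ : θ ∈ Ioo (0 : ℝ) 1)
    (hreg : RegularityCondition p θ) {f : ℝ → ℝ} (hf : IsTame f) (h0 : f 0 = 0) :
    Tendsto (fun t => (∑' i, f (p (i + 1) * t)) / countingFunction p t) atTop
      (𝓝 (∫ u in Ioi (0 : ℝ), f u * (θ * u ^ (-θ - 1)))) := by
  have hmono : Monotone (fun x => (countingFunction p x : ℝ)) :=
    Nat.mono_cast.comp (monotone_countingFunction hp_anti hp_pos hp_sum)
  have hatop := tendsto_countingFunction hp_anti hp_pos hp_sum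
  obtain ⟨ρ, hρ, D, hD⟩ := exists_potter_bound hmono hθ (hatop.eventually_gt_atTop 0)
    (fun c hc => tendsto_countingFunction_ratio hreg hc)
  rw [hf.integral_mul_rpow h0 hθ]
  have hev : ∀ᶠ t in atTop, (∫ v in Ioi (0 : ℝ), deriv f v *
      ((countingFunction p (t / v) : ℝ) / countingFunction p t))
      = (∑' i, f (p (i + 1) * t)) / countingFunction p t := by
    filter_upwards [eventually_gt_atTop 0] with t ht
    rw [(hasSum_tame_frequencies hp_anti hp_pos hp_sum hf h0 ht).tsum_eq, ← integral_div]
    simp_rw [mul_div_assoc]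
  refine Tendsto.congr' hev ?_
  refine tendsto_integral_filter_of_dominated_convergence
    (bound := fun v => |deriv f v| + |D| * |deriv f v * v ^ (-ρ)|) ?_ ?_ ?_ ?_
  · refine Eventually.of_forall fun t => ?_
    have : Measurable fun v : ℝ => (countingFunction p (t / v) : ℝ) :=
      hmono.measurable.comp (by fun_prop)
    exact (hf.continuous_deriv.measurable.mul (this.div_const _)).aestronglyMeasurable
  · filter_upwards [hD, hatop.eventually_gt_atTop 0, eventually_gt_atTop 0] with t h1 h2 ht
    filter_upwards [ae_restrict_mem measurableSet_Ioi] with v hv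
    have hv0 : (0 : ℝ) < v := hv
    have hr0 : 0 ≤ (countingFunction p (t / v) : ℝ) / countingFunction p t := by positivity
    rw [norm_mul, Real.norm_eq_abs, Real.norm_eq_abs, abs_of_nonneg hr0]
    by_cases hv1 : v ≤ 1
    · have h3 : (countingFunction p (t / v) : ℝ) / countingFunction p t ≤ |D| * v ^ (-ρ) :=
        (h1 v ⟨hv0, hv1⟩).trans (mul_le_mul_of_nonneg_right (le_abs_self D) (by positivity))
      rw [abs_mul, abs_of_nonneg (a := v ^ _) (by positivity)]
      have := mul_le_mul_of_nonneg_left h3 (abs_nonneg (deriv f v))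
      have := abs_nonneg (deriv f v)
      linarith
    · have h3 : (countingFunction p (t / v) : ℝ) / countingFunction p t ≤ 1 := by
        rw [div_le_one h2]
        exact hmono (div_le_self ht.le (not_le.1 hv1).le)
      have := mul_le_mul_of_nonneg_left h3 (abs_nonneg (deriv f v))
      have : 0 ≤ |D| * |deriv f v * v ^ (-ρ)| := by positivity
      linarith
  · exact hf.integrable.norm.add ((hf.integrableOn_deriv_mul_rpow hρ).norm.const_mul |D|)
  · filter_upwards [ae_restrict_mem measurableSet_Ioi] with v hv
    have hv0 : (0 : ℝ) < v := hv
    have := tendsto_countingFunction_ratio hreg (inv_pos.2 hv0)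
    rw [Real.inv_rpow hv0.le, ← Real.rpow_neg hv0.le] at this
    refine (this.congr fun t => ?_).const_mul (deriv f v)
    rw [inv_mul_eq_div]

omit hp_anti hp_pos hp_sum in
lemma isTame_one_sub_exp_neg : IsTame (fun u => 1 - poissonWeight 0 u) :=
  (IsTame.const 1).sub (isTame_poissonWeight 0)

omit hp_anti hp_pos hp_sum in
lemma integral_one_sub_exp_neg {θ : ℝ} (hθ : θ ∈ Ioo (0 : ℝ) 1) :
    ∫ u in Ioi (0 : ℝ), (1 - poissonWeight 0 u) * (θ * u ^ (-θ - 1)) = Real.Gamma (1 - θ) := by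
  rw [isTame_one_sub_exp_neg.integral_mul_rpow (by simp [poissonWeight]) hθ,
    Real.Gamma_eq_integral (by linarith [hθ.2])]
  refine setIntegral_congr_fun measurableSet_Ioi fun u _ => ?_
  have : deriv (fun u => 1 - poissonWeight 0 u) u = poissonWeight 0 u := by
    simpa using ((hasDerivAt_poissonWeight_zero u).const_sub 1).deriv
  simp only [this]
  simp [poissonWeight]

end Frequencies

end UrnScheme

namespace UrnScheme

/-! ### Characteristic functions of sums of small independent variables -/

lemma norm_prod_sub_prod_le {ι : Type*} (s : Finset ι) (a b : ι → ℂ)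
    (ha : ∀ i ∈ s, ‖a i‖ ≤ 1) (hb : ∀ i ∈ s, ‖b i‖ ≤ 1) :
    ‖∏ i ∈ s, a i - ∏ i ∈ s, b i‖ ≤ ∑ i ∈ s, ‖a i - b i‖ := by
  classical
  induction s using Finset.induction_on with
  | empty => simp
  | insert i s hi ih =>
    rw [Finset.prod_insert hi, Finset.prod_insert hi, Finset.sum_insert hi]
    have hbs : ‖∏ j ∈ s, b j‖ ≤ 1 := by
      rw [norm_prod]
      exact Finset.prod_le_one (fun _ _ => norm_nonneg _) fun j hj => hb j (by simp [hj])
    have e : a i * ∏ j ∈ s, a j - b i * ∏ j ∈ s, b j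
        = (a i - b i) * ∏ j ∈ s, b j + a i * (∏ j ∈ s, a j - ∏ j ∈ s, b j) := by ring
    rw [e]
    refine (norm_add_le _ _).trans (add_le_add ?_ ?_) <;> rw [norm_mul]
    · exact mul_le_of_le_one_right (norm_nonneg _) hbs
    · exact (mul_le_of_le_one_left (norm_nonneg _) (ha i (by simp))).trans
        (ih (fun j hj => ha j (by simp [hj])) fun j hj => hb j (by simp [hj]))

lemma norm_exp_I_sub_taylor_le {x : ℝ} (hx : |x| ≤ 1) :
    ‖Complex.exp (x * Complex.I) - (1 + x * Complex.I - x ^ 2 / 2)‖ ≤ |x| ^ 3 := by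
  have hn : ‖(x : ℂ) * Complex.I‖ = |x| := by simp
  have h := Complex.exp_bound (x := x * Complex.I) (by rwa [hn]) (n := 3) (by norm_num)
  rw [hn] at h
  have e : ∑ m ∈ Finset.range 3, ((x : ℂ) * Complex.I) ^ m / m.factorial
      = 1 + x * Complex.I - x ^ 2 / 2 := by
    simp [Finset.sum_range_succ, mul_pow, Complex.I_sq]
    ring
  rw [e] at h
  refine h.trans (mul_le_of_le_one_right (by positivity) ?_)
  norm_num [Nat.factorial]

variable {Ω : Type*} [MeasurableSpace Ω] {P : Measure Ω} [IsProbabilityMeasure P]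

/-- Second-order expansion of the characteristic function of a small centered variable. -/
lemma norm_integral_exp_sub_exp_le {Z : Ω → ℝ} {ε : ℝ} (hε : ε ≤ 1) (hZ : AEMeasurable Z P)
    (hb : ∀ᵐ ω ∂P, |Z ω| ≤ ε) (h0 : ∫ ω, Z ω ∂P = 0) :
    ‖∫ ω, Complex.exp (Z ω * Complex.I) ∂P
      - Complex.exp ((-(∫ ω, Z ω ^ 2 ∂P) / 2 : ℝ) : ℂ)‖ ≤ 2 * ε * ∫ ω, Z ω ^ 2 ∂P := by
  have hε0 : 0 ≤ ε := by
    obtain ⟨ω, hω⟩ := hb.exists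
    exact (abs_nonneg _).trans hω
  have hi1 : Integrable Z P := Integrable.of_bound hZ.aestronglyMeasurable ε hb
  have hsq : ∀ᵐ ω ∂P, Z ω ^ 2 ≤ ε ^ 2 := by
    filter_upwards [hb] with ω hω using sq_le_sq' (abs_le.1 hω).1 (abs_le.1 hω).2
  have hi2 : Integrable (fun ω => Z ω ^ 2) P :=
    Integrable.of_bound (hZ.pow_const 2).aestronglyMeasurable (ε ^ 2) (by
      filter_upwards [hsq] with ω hω
      rwa [Real.norm_eq_abs, abs_of_nonneg (sq_nonneg _)])
  set s := ∫ ω, Z ω ^ 2 ∂P with hs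
  have hs0 : 0 ≤ s := integral_nonneg fun ω => sq_nonneg _
  have hsε : s ≤ ε ^ 2 := by
    calc s ≤ ∫ _, ε ^ 2 ∂P := integral_mono_ae hi2 (integrable_const _) hsq
      _ = ε ^ 2 := by simp
  have hi3 : Integrable (fun ω => Complex.exp (Z ω * Complex.I)) P := by
    refine Integrable.of_bound (by fun_prop) 1 (ae_of_all _ fun ω => ?_)
    rw [Complex.norm_exp_ofReal_mul_I]
  have hi1c : Integrable (fun ω => (Z ω : ℂ)) P := hi1.ofReal
  have hi2c : Integrable (fun ω => (Z ω : ℂ) ^ 2) P := by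
    simpa using hi2.ofReal (𝕜 := ℂ)
  have e2 : ∫ ω, (Z ω : ℂ) ^ 2 ∂P = (s : ℂ) := by
    rw [hs, ← integral_complex_ofReal]; simp
  have e1 : ∫ ω, (Z ω : ℂ) ∂P = 0 := by
    rw [integral_complex_ofReal, h0]; simp
  have hiA : Integrable (fun ω => 1 + (Z ω : ℂ) * Complex.I) P :=
    (integrable_const _).add (hi1c.mul_const _)
  have hiT : Integrable (fun ω => 1 + (Z ω : ℂ) * Complex.I - (Z ω : ℂ) ^ 2 / 2) P :=
    hiA.sub (hi2c.div_const _)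
  have hT : ∫ ω, (1 + (Z ω : ℂ) * Complex.I - (Z ω : ℂ) ^ 2 / 2) ∂P = 1 - (s : ℂ) / 2 := by
    rw [integral_sub hiA (hi2c.div_const _),
      integral_add (integrable_const _) (hi1c.mul_const _), integral_mul_const, integral_div, e1, e2]
    simp
  have h1 : ‖∫ ω, Complex.exp (Z ω * Complex.I) ∂P - (1 - (s : ℂ) / 2)‖ ≤ ε * s := by
    rw [← hT, ← integral_sub hi3 hiT]
    refine (norm_integral_le_of_norm_le (hi2.const_mul ε) ?_).trans_eq (integral_const_mul _ _)
    filter_upwards [hb] with ω hω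
    refine (norm_exp_I_sub_taylor_le (hω.trans hε)).trans ?_
    rw [pow_succ, sq_abs, mul_comm]
    exact mul_le_mul_of_nonneg_right hω (sq_nonneg _)
  have hs1 : s ≤ 1 := hsε.trans (pow_le_one₀ hε0 hε)
  have h2 : ‖Complex.exp ((-s / 2 : ℝ) : ℂ) - (1 - (s : ℂ) / 2)‖ ≤ ε * s := by
    have := Real.abs_exp_sub_one_sub_id_le (x := -s / 2) (by
      rw [abs_le]; constructor <;> linarith)
    have e : Complex.exp ((-s / 2 : ℝ) : ℂ) - (1 - (s : ℂ) / 2)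
        = ((Real.exp (-s / 2) - 1 - (-s / 2) : ℝ) : ℂ) := by
      push_cast; ring
    rw [e, Complex.norm_real, Real.norm_eq_abs]
    refine this.trans ?_
    nlinarith [mul_nonneg hε0 hs0]
  calc _ = ‖(∫ ω, Complex.exp (Z ω * Complex.I) ∂P - (1 - (s : ℂ) / 2))
        - (Complex.exp ((-s / 2 : ℝ) : ℂ) - (1 - (s : ℂ) / 2))‖ := by congr 1; ring
    _ ≤ ε * s + ε * s := (norm_sub_le _ _).trans (add_le_add h1 h2)
    _ = _ := by ring

/-- Quantitative central limit theorem for finitely many small independent centered variables. -/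
lemma norm_integral_exp_sum_sub_exp_le {ι : Type*} [Fintype ι] {Z : ι → Ω → ℝ} {ε : ℝ}
    (hε : ε ≤ 1) (hZ : ∀ i, AEMeasurable (Z i) P) (hind : iIndepFun Z P)
    (hb : ∀ i, ∀ᵐ ω ∂P, |Z i ω| ≤ ε) (h0 : ∀ i, ∫ ω, Z i ω ∂P = 0) :
    ‖∫ ω, Complex.exp ((∑ i, Z i ω : ℝ) * Complex.I) ∂P
      - Complex.exp ((-(∑ i, ∫ ω, Z i ω ^ 2 ∂P) / 2 : ℝ) : ℂ)‖
      ≤ 2 * ε * ∑ i, ∫ ω, Z i ω ^ 2 ∂P := by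
  have e1 : ∫ ω, Complex.exp ((∑ i, Z i ω : ℝ) * Complex.I) ∂P
      = ∏ i, ∫ ω, Complex.exp (Z i ω * Complex.I) ∂P := by
    have hm : Measurable fun x : ℝ => Complex.exp (x * Complex.I) := by fun_prop
    have h := (hind.comp (fun _ x => Complex.exp (x * Complex.I))
      fun _ => hm).integral_fun_prod_eq_prod_integral
        fun i => (hm.comp_aemeasurable (hZ i)).aestronglyMeasurable
    simp only [Function.comp_apply] at h
    rw [← h]
    refine integral_congr_ae (ae_of_all _ fun ω => ?_)
    simp [Finset.sum_mul, Complex.exp_sum]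
  have e2 : Complex.exp ((-(∑ i, ∫ ω, Z i ω ^ 2 ∂P) / 2 : ℝ) : ℂ)
      = ∏ i, Complex.exp ((-(∫ ω, Z i ω ^ 2 ∂P) / 2 : ℝ) : ℂ) := by
    rw [← Complex.exp_sum, ← Complex.ofReal_sum, ← Finset.sum_div, Finset.sum_neg_distrib]
  rw [e1, e2, Finset.mul_sum]
  refine (norm_prod_sub_prod_le _ _ _ (fun i _ => ?_) (fun i _ => ?_)).trans
    (Finset.sum_le_sum fun i _ => norm_integral_exp_sub_exp_le hε (hZ i) (hb i) (h0 i))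
  · refine (norm_integral_le_of_norm_le_const (C := 1) (ae_of_all _ fun ω => ?_)).trans_eq
      (by simp)
    rw [Complex.norm_exp_ofReal_mul_I]
  · rw [Complex.norm_exp_ofReal, Real.exp_le_one_iff]
    have : 0 ≤ ∫ ω, Z i ω ^ 2 ∂P := integral_nonneg fun ω => sq_nonneg _
    linarith

end UrnScheme

namespace UrnScheme

/-! ### Poisson distributions -/

lemma poissonMeasure_real_eq_poissonWeight (r : ℝ≥0) (n : ℕ) :
    (poissonMeasure r).real {n} = poissonWeight n r := by
  rw [poissonMeasure_real_singleton, poissonWeight]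

lemma poissonMeasure_real_Iic (r : ℝ≥0) (n : ℕ) :
    (poissonMeasure r).real (Iic n) = ∑ j ∈ Finset.range (n + 1), poissonWeight j r := by
  have : (Iic n : Set ℕ) = ↑(Finset.range (n + 1)) := by ext; simp
  rw [this, ← sum_measureReal_singleton]
  exact Finset.sum_congr rfl fun j _ => poissonMeasure_real_eq_poissonWeight r j

lemma poissonMeasure_real_two_le (r : ℝ≥0) : (poissonMeasure r).real (Ici 2) ≤ (r : ℝ) ^ 2 := by
  have h1 : (Ici 2 : Set ℕ) = (Iic 1)ᶜ := by ext; simp [Nat.succ_le_iff]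
  rw [h1, probReal_compl_eq_one_sub (by measurability), poissonMeasure_real_Iic]
  simp only [Finset.sum_range_succ, Finset.range_zero, Finset.sum_empty, poissonWeight]
  have h2 := Real.add_one_le_exp (-(r : ℝ))
  have h3 := r.coe_nonneg
  simp
  nlinarith

lemma lintegral_cast_poissonMeasure (r : ℝ≥0) :
    ∫⁻ k : ℕ, (k : ENNReal) ∂(poissonMeasure r) = r := by
  have hw : ∀ k, poissonMeasure r {k} = ENNReal.ofReal (poissonWeight k r) := fun k => by
    rw [← poissonMeasure_real_eq_poissonWeight, ofReal_measureReal]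
  have h1 : ∑' k, ENNReal.ofReal (poissonWeight k r) = 1 := by
    simp_rw [← hw]
    have := lintegral_countable' (μ := poissonMeasure r) (fun _ => 1)
    simpa using this.symm
  rw [lintegral_countable', tsum_eq_zero_add' ENNReal.summable]
  simp_rw [hw]
  have h2 : ∀ k : ℕ, ((k + 1 : ℕ) : ENNReal) * ENNReal.ofReal (poissonWeight (k + 1) r)
      = r * ENNReal.ofReal (poissonWeight k r) := by
    intro k
    rw [← ENNReal.ofReal_natCast, ← ENNReal.ofReal_mul (by positivity), ← ENNReal.ofReal_coe_nnreal,
      ← ENNReal.ofReal_mul r.coe_nonneg]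
    congr 1
    simp only [poissonWeight, Nat.factorial_succ]
    push_cast
    have : (k.factorial : ℝ) ≠ 0 := by positivity
    field_simp
    ring
  simp_rw [h2]
  rw [ENNReal.tsum_mul_left, h1]
  simp

lemma integral_pow_poissonMeasure (r : ℝ≥0) (z : ℂ) :
    ∫ k, z ^ k ∂(poissonMeasure r) = Complex.exp (r * (z - 1)) := by
  rw [integral_poissonMeasure r]
  calc ∑' a : ℕ, (Real.exp (-r) * r ^ a / a.factorial : ℝ) • z ^ a
      = ∑' a : ℕ, (Real.exp (-r) : ℂ) * ((r * z) ^ a / a.factorial) := by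
        congr with a
        rw [Complex.real_smul]
        push_cast
        ring
    _ = (Real.exp (-r) : ℂ) * Complex.exp (r * z) := by
        rw [tsum_mul_left, (NormedSpace.expSeries_div_hasSum_exp (r * z : ℂ)).tsum_eq,
          Complex.exp_eq_exp_ℂ]
    _ = Complex.exp (r * (z - 1)) := by
        rw [Complex.ofReal_exp, ← Complex.exp_add]
        push_cast
        ring_nf

/-! ### Paths and arrival times -/

/-- Paths of a counting process with infinitely many arrivals. -/
structure IsCountingPath (f : ℝ≥0 → ℕ) : Prop where
  zero : f 0 = 0
  mono : Monotone f
  rightCont : ∀ t, ContinuousWithinAt f (Ici t) t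
  unbounded : ∀ n, ∃ s, n ≤ f s

/-- The time of arrival number `n + 1`, as a measurable function of the path. -/
noncomputable def pathArrival (n : ℕ) (f : ℝ≥0 → ℕ) : ℝ :=
  (⨅ q : ℚ≥0, if n < f q then ((q : ℝ≥0) : ENNReal) else ⊤).toReal

lemma measurable_pathArrival (n : ℕ) : Measurable (pathArrival n) := by
  refine ENNReal.measurable_toReal.comp (Measurable.iInf fun q => ?_)
  refine Measurable.ite ?_ measurable_const measurable_const
  exact measurableSet_lt measurable_const (measurable_pi_apply _)

namespace IsCountingPath

variable {Ω : Type*} {N : ℝ≥0 → Ω → ℕ} {ω : Ω}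

lemma arrivalTime_le_iff (h : IsCountingPath (fun s => N s ω)) (n : ℕ) (s : ℝ≥0) :
    arrivalTime N n ω ≤ s ↔ n ≤ N s ω := by
  have hne : {s : ℝ≥0 | n ≤ N s ω}.Nonempty := h.unbounded n
  rw [arrivalTime, NNReal.coe_le_coe]
  constructor
  · intro hs
    have hmem := h.rightCont (sInf {s : ℝ≥0 | n ≤ N s ω})
      (IsOpen.mem_nhds (isOpen_discrete {N (sInf {s : ℝ≥0 | n ≤ N s ω}) ω}) rfl)
    rw [mem_map, mem_nhdsGE_iff_exists_Ico_subset] at hmem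
    obtain ⟨u, hu, hsub⟩ := hmem
    obtain ⟨v, hv, hvu⟩ := exists_lt_of_csInf_lt hne hu
    have h1 : N v ω = N (sInf {s : ℝ≥0 | n ≤ N s ω}) ω :=
      hsub ⟨csInf_le (OrderBot.bddBelow _) hv, hvu⟩
    have h2 : n ≤ N v ω := hv
    exact (h1 ▸ h2).trans (h.mono hs)
  · exact fun hs => csInf_le (OrderBot.bddBelow _) hs

lemma pathArrival_eq (h : IsCountingPath (fun s => N s ω)) (n : ℕ) :
    pathArrival n (fun s => N s ω) = arrivalTime N (n + 1) ω := by
  set T : ℝ≥0 := sInf {s : ℝ≥0 | n + 1 ≤ N s ω} with hT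
  have hle : ∀ s : ℝ≥0, T ≤ s ↔ n < N s ω := fun s => by
    rw [← Nat.succ_le_iff, ← h.arrivalTime_le_iff (n + 1) s, arrivalTime, NNReal.coe_le_coe]
  suffices e : (⨅ q : ℚ≥0, if n < N (q : ℝ≥0) ω then ((q : ℝ≥0) : ENNReal) else ⊤) = (T : ENNReal) by
    rw [pathArrival, e]; rfl
  refine le_antisymm (le_of_forall_gt fun c hc => ?_) (le_iInf fun q => ?_)
  · obtain ⟨q, hq1, hq2⟩ := ENNReal.lt_iff_exists_nnreal_btwn.1 hc
    obtain ⟨r, hr1, hr2⟩ := exists_rat_btwn (NNReal.coe_lt_coe.2 (ENNReal.coe_lt_coe.1 hq1))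
    have hr0 : 0 ≤ r := by
      have : (0 : ℝ) < r := T.coe_nonneg.trans_lt hr1
      exact_mod_cast this.le
    lift r to ℚ≥0 using hr0
    have hr1' : T ≤ (r : ℝ≥0) := by
      rw [← NNReal.coe_le_coe]; exact_mod_cast hr1.le
    have hr2' : (r : ℝ≥0) < q := by
      rw [← NNReal.coe_lt_coe]; exact_mod_cast hr2
    refine (iInf_le _ r).trans_lt ?_
    rw [if_pos ((hle _).1 hr1')]
    exact (ENNReal.coe_lt_coe.2 hr2').trans hq2
  · split_ifs with hq
    · exact ENNReal.coe_le_coe.2 ((hle _).2 hq)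
    · exact le_top

lemma pathArrival_le_iff (h : IsCountingPath (fun s => N s ω)) (n : ℕ) (s : ℝ≥0) :
    pathArrival n (fun s => N s ω) ≤ s ↔ n < N s ω := by
  rw [h.pathArrival_eq, h.arrivalTime_le_iff, Nat.succ_le_iff]

lemma pathArrival_pos (h : IsCountingPath (fun s => N s ω)) (n : ℕ) :
    0 < pathArrival n (fun s => N s ω) := by
  by_contra hn
  have h1 := (h.pathArrival_le_iff n 0).1 (by simpa using hn)
  have h2 : N 0 ω = 0 := h.zero
  omega

end IsCountingPath

end UrnScheme

namespace IsUnitPoissonProcess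

open UrnScheme

variable {Ω : Type*} [MeasurableSpace Ω] {P : Measure Ω} [IsProbabilityMeasure P]
  {N : ℝ≥0 → Ω → ℕ} (hN : IsUnitPoissonProcess N P)
include hN

omit [IsProbabilityMeasure P] in
lemma hasLaw (t : ℝ≥0) : HasLaw (N t) (poissonMeasure t) P := by
  have h := hN.law_increments 0 t zero_le
  rw [tsub_zero] at h
  refine h.congr ?_
  filter_upwards [hN.paths] with ω hω
  simp [hω.1]

omit [IsProbabilityMeasure P] in
lemma measureReal_preimage (t : ℝ≥0) (s : Set ℕ) :
    P.real (N t ⁻¹' s) = (poissonMeasure t).real s := by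
  rw [← (hN.hasLaw t).map_eq, map_measureReal_apply (hN.measurable t) (by measurability)]

lemma ae_isCountingPath : ∀ᵐ ω ∂P, IsCountingPath (fun s => N s ω) := by
  have hunb : ∀ n : ℕ, ∀ᵐ ω ∂P, ∃ s, n ≤ N s ω := by
    intro n
    rw [ae_iff, ← measureReal_eq_zero_iff]
    refine le_antisymm ?_ measureReal_nonneg
    have hlim : Tendsto (fun j : ℕ => ∑ i ∈ Finset.range (n + 1), poissonWeight i ((j : ℝ≥0) : ℝ))
        atTop (𝓝 0) := by
      rw [← Finset.sum_const_zero (s := Finset.range (n + 1))]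
      refine tendsto_finsetSum _ fun i _ => ?_
      have := ((Real.tendsto_pow_mul_exp_neg_atTop_nhds_zero i).div_const
        (i.factorial : ℝ)).comp tendsto_natCast_atTop_atTop
      rw [zero_div] at this
      refine this.congr fun j => ?_
      simp [poissonWeight, mul_comm]
    refine ge_of_tendsto' hlim fun j => ?_
    rw [← poissonMeasure_real_Iic, ← hN.measureReal_preimage]
    refine measureReal_mono fun ω hω => ?_
    simp only [mem_ofPred_eq, not_exists, not_le] at hω
    exact (hω _).le
  filter_upwards [hN.paths, ae_all_iff.2 hunb] with ω h1 h2
  exact ⟨h1.1, h1.2.1, h1.2.2, h2⟩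

/-- Almost surely the arrival times are distinct. -/
lemma ae_arrivalTime_lt : ∀ᵐ ω ∂P, ∀ n, arrivalTime N n ω < arrivalTime N (n + 1) ω := by
  have hgrid : ∀ᵐ ω ∂P, ∀ t : ℕ, ∃ m : ℕ, 1 ≤ m ∧ ∀ j < m,
      N ((j + 1 : ℕ) * t / m) ω - N ((j : ℕ) * t / m) ω < 2 := by
    refine ae_all_iff.2 fun t => ?_
    rw [ae_iff, ← measureReal_eq_zero_iff]
    refine le_antisymm ?_ measureReal_nonneg
    have hlim : Tendsto (fun m : ℕ => (t : ℝ) ^ 2 / (m : ℝ)) atTop (𝓝 0) :=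
      tendsto_const_div_atTop_nhds_zero_nat _
    refine ge_of_tendsto hlim ?_
    filter_upwards [eventually_ge_atTop 1] with m hm
    have hm0 : (m : ℝ) ≠ 0 := by positivity
    have hK : ∀ j : ℕ, P.real {ω | 2 ≤ N ((j + 1 : ℕ) * t / m) ω - N ((j : ℕ) * t / m) ω}
        ≤ ((t : ℝ) / m) ^ 2 := by
      intro j
      have hle : ((j : ℕ) * t / m : ℝ≥0) ≤ ((j + 1 : ℕ) * t / m : ℝ≥0) := by
        gcongr; simp
      have hlaw := hN.law_increments _ _ hle
      have hsub : ((j + 1 : ℕ) * t / m : ℝ≥0) - ((j : ℕ) * t / m : ℝ≥0) = t / m := by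
        rw [← NNReal.coe_inj, NNReal.coe_sub hle]
        push_cast
        ring
      rw [hsub] at hlaw
      have h2 := poissonMeasure_real_two_le (t / m : ℝ≥0)
      rw [← hlaw.map_eq, map_measureReal_apply (by
        exact (hN.measurable _).sub (hN.measurable _)) (by measurability)] at h2
      refine h2.trans_eq (by simp)
    calc _ ≤ P.real (⋃ j ∈ Finset.range m,
          {ω | 2 ≤ N ((j + 1 : ℕ) * t / m) ω - N ((j : ℕ) * t / m) ω}) := by
          refine measureReal_mono (fun ω hω => ?_) (measure_ne_top _ _)
          simp only [mem_ofPred_eq, not_exists, not_and, not_forall, not_lt] at hω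
          obtain ⟨j, hj, h2⟩ := hω m hm
          simp only [mem_iUnion, Finset.mem_range]
          exact ⟨j, hj, h2⟩
      _ ≤ ∑ j ∈ Finset.range m, ((t : ℝ) / m) ^ 2 :=
          (measureReal_biUnion_finset_le _ _).trans (Finset.sum_le_sum fun j _ => hK j)
      _ = (t : ℝ) ^ 2 / m := by
          rw [Finset.sum_const, Finset.card_range, nsmul_eq_mul]
          field_simp
  filter_upwards [hN.ae_isCountingPath, hgrid] with ω hω hg n
  by_contra hlt
  rw [not_lt] at hlt
  set T : ℝ≥0 := sInf {s : ℝ≥0 | n ≤ N s ω} with hT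
  have hTn : arrivalTime N n ω = T := rfl
  rw [hTn, hω.arrivalTime_le_iff] at hlt
  have hT0 : 0 < T := by
    rw [pos_iff_ne_zero]
    intro h0
    rw [h0] at hlt
    have : N 0 ω = 0 := hω.zero
    omega
  obtain ⟨t, ht⟩ := exists_nat_ge (T : ℝ)
  have ht0 : (0 : ℝ) < t := lt_of_lt_of_le (NNReal.coe_pos.2 hT0) ht
  obtain ⟨m, hm, hj⟩ := hg t
  have hm0 : (0 : ℝ) < m := by exact_mod_cast hm
  have hx0 : 0 < (T : ℝ) * m / t := by have := NNReal.coe_pos.2 hT0; positivity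
  set c := ⌈(T : ℝ) * m / t⌉₊ with hc
  have hc1 : 1 ≤ c := Nat.one_le_ceil_iff.2 hx0
  have hcm : c ≤ m := by
    rw [hc, Nat.ceil_le, div_le_iff₀ ht0, mul_comm]
    exact mul_le_mul_of_nonneg_left ht hm0.le
  have h1 := hj (c - 1) (by omega)
  rw [Nat.sub_add_cancel hc1] at h1
  have hup : T ≤ (c * t / m : ℝ≥0) := by
    have := Nat.le_ceil ((T : ℝ) * m / t)
    rw [div_le_iff₀ ht0] at this
    rw [← NNReal.coe_le_coe]
    push_cast
    rwa [le_div_iff₀ hm0]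
  have hlo : ((c - 1 : ℕ) * t / m : ℝ≥0) < T := by
    have : ((c - 1 : ℕ) : ℝ) < (T : ℝ) * m / t := Nat.lt_ceil.1 (by omega)
    rw [lt_div_iff₀ ht0] at this
    rw [← NNReal.coe_lt_coe]
    simp only [NNReal.coe_div, NNReal.coe_mul, NNReal.coe_natCast]
    rwa [div_lt_iff₀ hm0]
  have h2 : n + 1 ≤ N (c * t / m) ω := hlt.trans (hω.mono hup)
  have h3 : N ((c - 1 : ℕ) * t / m) ω < n := by
    by_contra h
    rw [not_lt, ← hω.arrivalTime_le_iff, hTn, NNReal.coe_le_coe] at h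
    exact absurd hlo (not_lt.2 h)
  omega

end IsUnitPoissonProcess

namespace UrnScheme

/-- The time of arrival number `n + 1`, in a version which is a measurable function of the path. -/
noncomputable def tau {Ω : Type*} (N : ℝ≥0 → Ω → ℕ) (n : ℕ) (ω : Ω) : ℝ :=
  pathArrival n (fun s => N s ω)

@[to_additive]
lemma measurable_prod_range {α M : Type*} [MeasurableSpace α] [CommMonoid M] [MeasurableSpace M]
    [MeasurableMul₂ M] {K : α → ℕ} (hK : Measurable K) {F : ℕ → α → M}
    (hF : ∀ n, Measurable (F n)) :
    Measurable (fun x => ∏ n ∈ Finset.range (K x), F n x) := by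
  have h : Measurable (fun y : ℕ × α => ∏ n ∈ Finset.range y.1, F n y.2) :=
    measurable_from_prod_countable_right fun k =>
      Finset.measurable_fun_prod (Finset.range k) fun n _ => hF n
  exact h.comp (hK.prodMk measurable_id)

lemma norm_prod_le_one {ι : Type*} (s : Finset ι) {a : ι → ℂ} (ha : ∀ i, ‖a i‖ ≤ 1) :
    ‖∏ i ∈ s, a i‖ ≤ 1 := by
  rw [norm_prod]
  exact Finset.prod_le_one (fun _ _ => norm_nonneg _) fun i _ => ha i

/-- Rounding `x` up to the grid of mesh `t / m`. -/
noncomputable def gridCeil (t : ℝ) (m : ℕ) (x : ℝ) : ℝ := ⌈x * m / t⌉₊ * t / m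

lemma measurable_gridCeil (t : ℝ) (m : ℕ) : Measurable (gridCeil t m) := by
  unfold gridCeil
  have : Measurable fun x : ℝ => ((⌈x * m / t⌉₊ : ℕ) : ℝ) :=
    measurable_from_nat.comp (Nat.measurable_ceil.comp (by fun_prop))
  exact (this.mul_const _).div_const _

lemma gridCeil_eq {t : ℝ} (ht : 0 < t) {m : ℕ} (hm : 0 < m) {j : ℕ} {x : ℝ}
    (h1 : (j : ℝ) * t / m < x) (h2 : x ≤ ((j + 1 : ℕ) : ℝ) * t / m) :
    gridCeil t m x = ((j + 1 : ℕ) : ℝ) * t / m := by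
  have hm0 : (0 : ℝ) < m := by exact_mod_cast hm
  have : ⌈x * m / t⌉₊ = j + 1 := by
    rw [Nat.ceil_eq_iff (by omega)]
    constructor
    · rw [lt_div_iff₀ ht]
      rwa [div_lt_iff₀ hm0] at h1
    · rw [div_le_iff₀ ht]
      rwa [le_div_iff₀ hm0] at h2
  rw [gridCeil, this]

lemma tendsto_gridCeil {t : ℝ} (ht : 0 < t) {x : ℝ} (hx : 0 ≤ x) :
    Tendsto (fun m => gridCeil t m x) atTop (𝓝 x) := by
  have h1 : Tendsto (fun m : ℕ => x + t / m) atTop (𝓝 x) := by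
    simpa using (tendsto_const_div_atTop_nhds_zero_nat t).const_add x
  refine tendsto_of_tendsto_of_tendsto_of_le_of_le' tendsto_const_nhds h1 ?_ ?_
  · filter_upwards [eventually_gt_atTop 0] with m hm
    have hm0 : (0 : ℝ) < m := by exact_mod_cast hm
    have := Nat.le_ceil (x * m / t)
    rw [div_le_iff₀ ht] at this
    rwa [gridCeil, le_div_iff₀ hm0]
  · filter_upwards [eventually_gt_atTop 0] with m hm
    have hm0 : (0 : ℝ) < m := by exact_mod_cast hm
    have := (Nat.ceil_lt_add_one (show 0 ≤ x * m / t by positivity)).le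
    rw [gridCeil, div_le_iff₀ hm0]
    calc _ ≤ (x * m / t + 1) * t := by gcongr
      _ = _ := by field_simp

/-- Riemann sums as integrals over the rounding map. -/
lemma sum_riemann_eq_integral {t : ℝ} (ht : 0 < t) {m : ℕ} (hm : 0 < m) (G : ℝ → ℂ) :
    ∑ j ∈ Finset.range m, ((t / m : ℝ) : ℂ) * G (((j + 1 : ℕ) : ℝ) * t / m)
      = ∫ s in (0 : ℝ)..t, G (gridCeil t m s) := by
  have hm0 : (0 : ℝ) < m := by exact_mod_cast hm
  have hle : ∀ j : ℕ, (j : ℝ) * t / m ≤ ((j + 1 : ℕ) : ℝ) * t / m := fun j => by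
    gcongr; simp
  have hcongr : ∀ j : ℕ, ∀ s ∈ Ioc ((j : ℝ) * t / m) (((j + 1 : ℕ) : ℝ) * t / m),
      G (((j + 1 : ℕ) : ℝ) * t / m) = G (gridCeil t m s) := fun j s hs => by
    rw [gridCeil_eq ht hm hs.1 hs.2]
  have h := intervalIntegral.sum_integral_adjacent_intervals (μ := volume) (n := m)
    (f := fun s => G (gridCeil t m s)) (a := fun j : ℕ => (j : ℝ) * t / m) (fun j _ => by
      rw [intervalIntegrable_iff_integrableOn_Ioc_of_le (hle j)]
      exact (integrableOn_const (by simp)).congr_fun (hcongr j) measurableSet_Ioc)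
  simp only [Nat.cast_zero, zero_mul, zero_div] at h
  rw [mul_div_cancel_left₀ t hm0.ne'] at h
  rw [← h]
  refine Finset.sum_congr rfl fun j _ => ?_
  rw [intervalIntegral.integral_of_le (hle j),
    ← setIntegral_congr_fun measurableSet_Ioc (hcongr j)]
  simp only [integral_const, measureReal_restrict_apply_univ, Complex.real_smul]
  rw [Real.volume_real_Ioc_of_le (hle j)]
  congr 2
  push_cast
  ring

end UrnScheme

namespace IsUnitPoissonProcess

open UrnScheme

variable {Ω : Type*} [MeasurableSpace Ω] {P : Measure Ω} [IsProbabilityMeasure P]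
  {N : ℝ≥0 → Ω → ℕ} (hN : IsUnitPoissonProcess N P)
include hN

omit [IsProbabilityMeasure P] in
lemma measurable_tau (n : ℕ) : Measurable (tau N n) :=
  (measurable_pathArrival n).comp (measurable_pi_iff.2 hN.measurable)

/-- The intensity measure of the arrival times is the Lebesgue measure. -/
lemma sum_map_tau : Measure.sum (fun n => P.map (tau N n)) = volume.restrict (Ioi 0) := by
  symm
  refine Measure.ext_of_Ioc _ _ fun a b hab => ?_
  set a' := a.toNNReal
  set b' := b.toNNReal
  have hab' : a' ≤ b' := Real.toNNReal_le_toNNReal hab.le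
  have hinter : Ioc a b ∩ Ioi 0 = Ioc (a' : ℝ) b' := by
    ext x
    simp only [mem_inter_iff, mem_Ioc, mem_Ioi, a', b', Real.coe_toNNReal', max_lt_iff, le_max_iff]
    constructor
    · rintro ⟨⟨h1, h2⟩, h3⟩; exact ⟨⟨h1, h3⟩, Or.inl h2⟩
    · rintro ⟨⟨h1, h3⟩, h2 | h2⟩
      · exact ⟨⟨h1, h2⟩, h3⟩
      · exact absurd h3 (not_lt.2 h2)
  rw [Measure.restrict_apply measurableSet_Ioc, hinter, Real.volume_Ioc,
    Measure.sum_apply _ measurableSet_Ioc]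
  have h1 : ∀ n, P.map (tau N n) (Ioc a b)
      = ∫⁻ ω, (if N a' ω ≤ n ∧ n < N b' ω then 1 else 0) ∂P := by
    intro n
    rw [Measure.map_apply (hN.measurable_tau n) measurableSet_Ioc,
      ← lintegral_indicator_one ((hN.measurable_tau n) measurableSet_Ioc)]
    refine lintegral_congr_ae ?_
    filter_upwards [hN.ae_isCountingPath] with ω hω
    have hmem : tau N n ω ∈ Ioc a b ↔ N a' ω ≤ n ∧ n < N b' ω := by
      rw [← and_iff_left (a := tau N n ω ∈ Ioc a b)
        (show tau N n ω ∈ Ioi 0 from hω.pathArrival_pos n), ← mem_inter_iff, hinter, mem_Ioc,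
        tau, hω.pathArrival_le_iff, ← not_le, hω.pathArrival_le_iff, not_lt]
    by_cases hc : N a' ω ≤ n ∧ n < N b' ω
    · rw [if_pos hc]; exact indicator_of_mem (s := tau N n ⁻¹' Ioc a b) (hmem.2 hc) _
    · rw [if_neg hc]; exact indicator_of_notMem (s := tau N n ⁻¹' Ioc a b) (fun h => hc (hmem.1 h)) _
  have hmeas : ∀ n, Measurable (fun ω => if N a' ω ≤ n ∧ n < N b' ω then (1 : ENNReal) else 0) :=
    fun n => Measurable.ite ((measurableSet_le (hN.measurable _) measurable_const).inter
      (measurableSet_lt measurable_const (hN.measurable _))) measurable_const measurable_const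
  simp_rw [h1]
  rw [← lintegral_tsum fun n => (hmeas n).aemeasurable]
  have h2 : ∀ ω, ∑' n, (if N a' ω ≤ n ∧ n < N b' ω then (1 : ENNReal) else 0)
      = ((N b' ω - N a' ω : ℕ) : ENNReal) := by
    intro ω
    rw [tsum_eq_sum (s := Finset.Ico (N a' ω) (N b' ω)) fun n hn => by
      rw [Finset.mem_Ico] at hn; rw [if_neg hn]]
    rw [Finset.sum_congr rfl fun n hn => if_pos (Finset.mem_Ico.1 hn)]
    simp
  simp_rw [h2]
  have hlaw := hN.law_increments a' b' hab'
  have h3 : ∫⁻ ω, ((N b' ω - N a' ω : ℕ) : ENNReal) ∂P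
      = ∫⁻ k : ℕ, (k : ENNReal) ∂(P.map fun ω => N b' ω - N a' ω) :=
    (lintegral_map (f := fun k : ℕ => (k : ENNReal)) (by fun_prop)
      ((hN.measurable _).sub (hN.measurable _))).symm
  rw [h3, hlaw.map_eq, lintegral_cast_poissonMeasure, ← ENNReal.ofReal_coe_nnreal,
    NNReal.coe_sub hab']

lemma ae_forall_tau {q : ℝ → Prop} (hq : ∀ᵐ x : ℝ, q x) : ∀ᵐ ω ∂P, ∀ n, q (tau N n ω) := by
  have h : ∀ᵐ x ∂(Measure.sum (fun n => P.map (tau N n))), q x := by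
    rw [hN.sum_map_tau]
    exact ae_restrict_of_ae hq
  rw [Measure.ae_sum_iff] at h
  exact ae_all_iff.2 fun n => ae_of_ae_map (hN.measurable_tau n).aemeasurable (h n)

omit [IsProbabilityMeasure P] in
lemma integral_pow_increment {s t : ℝ≥0} (hst : s ≤ t) (z : ℂ) :
    ∫ ω, z ^ (N t ω - N s ω) ∂P = Complex.exp (((t - s : ℝ≥0) : ℂ) * (z - 1)) := by
  have hlaw := hN.law_increments s t hst
  rw [← integral_pow_poissonMeasure, ← hlaw.map_eq]
  exact (integral_map (f := fun k : ℕ => z ^ k)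
    ((hN.measurable t).sub (hN.measurable s)).aemeasurable .of_discrete).symm

/-- The product functional of the Poisson process on step functions. -/
lemma integral_prod_gridCeil {t : ℝ≥0} (ht : 0 < t) {m : ℕ} (hm : 0 < m) (H : ℝ → ℂ) :
    ∫ ω, ∏ n ∈ Finset.range (N t ω), H (gridCeil t m (tau N n ω)) ∂P
      = Complex.exp (∫ s in (0 : ℝ)..t, (H (gridCeil t m s) - 1)) := by
  have ht' : (0 : ℝ) < t := ht
  have hm0 : (m : ℝ≥0) ≠ 0 := by positivity
  set g : ℕ → ℝ≥0 := fun j => (j : ℝ≥0) * t / m with hg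
  have hgc : ∀ j, (g j : ℝ) = (j : ℝ) * t / m := fun j => by simp [hg]
  have hgm : Monotone g := fun i j hij => by
    simp only [hg]; gcongr
  have hpath : ∀ᵐ ω ∂P, ∏ n ∈ Finset.range (N t ω), H (gridCeil t m (tau N n ω))
      = ∏ j : Fin m, H (g (j + 1)) ^ (N (g (j + 1)) ω - N (g j) ω) := by
    filter_upwards [hN.ae_isCountingPath] with ω hω
    have key : ∀ J : ℕ, ∏ n ∈ Finset.range (N (g J) ω), H (gridCeil t m (tau N n ω))
        = ∏ j ∈ Finset.range J, H (g (j + 1)) ^ (N (g (j + 1)) ω - N (g j) ω) := by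
      intro J
      induction J with
      | zero =>
        have : N 0 ω = 0 := hω.zero
        simp [hg, this]
      | succ J ih =>
        rw [Finset.prod_range_succ, ← ih,
          ← Finset.prod_range_mul_prod_Ico _ (hω.mono (hgm (Nat.le_succ J)))]
        congr 1
        rw [← Nat.card_Ico, ← Finset.prod_const]
        refine Finset.prod_congr rfl fun n hn => ?_
        rw [Finset.mem_Ico] at hn
        rw [hgc, gridCeil_eq ht' hm]
        · rw [← hgc, ← not_le]
          exact fun h => absurd ((hω.pathArrival_le_iff n _).1 h) (not_lt.2 hn.1)
        · rw [← hgc]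
          exact (hω.pathArrival_le_iff n _).2 hn.2
    have e : g m = t := by
      simp only [hg]
      rw [mul_div_cancel_left₀ _ hm0]
    have := key m
    rw [e] at this
    rw [this, Finset.prod_range]
  rw [integral_congr_ae hpath]
  have hind := ((hN.indep_increments.nat hgm).precomp (Fin.val_injective (n := m))).comp
    (fun j k => H (g (j + 1)) ^ k) (fun j => measurable_from_nat)
  have h := hind.integral_fun_prod_eq_prod_integral fun j =>
    (measurable_from_nat (f := fun k => H (g ((j : ℕ) + 1)) ^ k)).comp_aemeasurable
      ((hN.measurable _).sub (hN.measurable _)).aemeasurable |>.aestronglyMeasurable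
  simp only [Function.comp_apply] at h
  rw [h, ← sum_riemann_eq_integral ht' hm (fun x => H x - 1), Complex.exp_sum, Finset.prod_range]
  refine Finset.prod_congr rfl fun j _ => ?_
  rw [hN.integral_pow_increment (hgm (Nat.le_succ _)), hgc]
  congr 2
  have : ((g (j + 1) - g j : ℝ≥0) : ℝ) = t / m := by
    rw [NNReal.coe_sub (hgm (Nat.le_succ _)), hgc, hgc]
    push_cast
    ring
  rw [← this]

lemma tendsto_integral_prod {t : ℝ≥0} {F : ℕ → ℝ → ℂ} {H : ℝ → ℂ}
    (hF : ∀ k, Measurable (F k)) (hF1 : ∀ k x, ‖F k x‖ ≤ 1)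
    (hlim : ∀ᵐ x : ℝ, x ∈ Ioc (0 : ℝ) t → Tendsto (fun k => F k x) atTop (𝓝 (H x))) :
    Tendsto (fun k => ∫ ω, ∏ n ∈ Finset.range (N t ω), F k (tau N n ω) ∂P) atTop
      (𝓝 (∫ ω, ∏ n ∈ Finset.range (N t ω), H (tau N n ω) ∂P)) := by
  refine tendsto_integral_of_dominated_convergence (fun _ => 1) (fun k => ?_)
    (integrable_const _) (fun k => ae_of_all _ fun ω => norm_prod_le_one _ fun n => hF1 k _) ?_
  · exact (measurable_prod_range (hN.measurable t)
      fun n => (hF k).comp (hN.measurable_tau n)).aestronglyMeasurable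
  · filter_upwards [hN.ae_isCountingPath, hN.ae_forall_tau hlim] with ω h1 h2
    refine tendsto_finsetProd _ fun n hn => h2 n ⟨h1.pathArrival_pos n, ?_⟩
    exact (h1.pathArrival_le_iff n t).2 (Finset.mem_range.1 hn)

omit hN in
lemma tendsto_exp_intervalIntegral {t : ℝ≥0} {F : ℕ → ℝ → ℂ} {H : ℝ → ℂ}
    (hF : ∀ k, Measurable (F k)) (hF1 : ∀ k x, ‖F k x‖ ≤ 1)
    (hlim : ∀ᵐ x : ℝ, x ∈ Ioc (0 : ℝ) t → Tendsto (fun k => F k x) atTop (𝓝 (H x))) :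
    Tendsto (fun k => Complex.exp (∫ s in (0 : ℝ)..t, (F k s - 1))) atTop
      (𝓝 (Complex.exp (∫ s in (0 : ℝ)..t, (H s - 1)))) := by
  refine (Complex.continuous_exp.tendsto _).comp ?_
  refine intervalIntegral.tendsto_integral_filter_of_dominated_convergence (fun _ => 2)
    (Eventually.of_forall fun k => ((hF k).sub_const 1).aestronglyMeasurable)
    (Eventually.of_forall fun k => ae_of_all _ fun x _ => ?_) (by simp) ?_
  · refine (norm_sub_le _ _).trans ?_
    have := hF1 k x
    simp only [norm_one]
    linarith
  · filter_upwards [hlim] with x hx hxt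
    rw [uIoc_of_le t.coe_nonneg] at hxt
    exact (hx hxt).sub_const 1

lemma integral_prod_of_continuous {t : ℝ≥0} (ht : 0 < t) {H : ℝ → ℂ} (hH : Continuous H)
    (hH1 : ∀ x, ‖H x‖ ≤ 1) :
    ∫ ω, ∏ n ∈ Finset.range (N t ω), H (tau N n ω) ∂P
      = Complex.exp (∫ s in (0 : ℝ)..t, (H s - 1)) := by
  have hm : ∀ k : ℕ, Measurable fun x => H (gridCeil t k x) := fun k =>
    hH.measurable.comp (measurable_gridCeil t k)
  have hlim : ∀ᵐ x : ℝ, x ∈ Ioc (0 : ℝ) t →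
      Tendsto (fun k => H (gridCeil t k x)) atTop (𝓝 (H x)) :=
    ae_of_all _ fun x hx => (hH.tendsto x).comp (tendsto_gridCeil (NNReal.coe_pos.2 ht) hx.1.le)
  refine tendsto_nhds_unique (hN.tendsto_integral_prod hm (fun k x => hH1 _) hlim)
    ((tendsto_exp_intervalIntegral hm (fun k x => hH1 _) hlim).congr' ?_)
  filter_upwards [eventually_gt_atTop 0] with m hm0
  exact (hN.integral_prod_gridCeil ht hm0 H).symm

/-- The probability generating functional of the Poisson process. -/
theorem integral_prod {t : ℝ≥0} (ht : 0 < t) {H : ℝ → ℂ} (hH : Measurable H)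
    (hH1 : ∀ x, ‖H x‖ ≤ 1) :
    ∫ ω, ∏ n ∈ Finset.range (N t ω), H (tau N n ω) ∂P
      = Complex.exp (∫ s in (0 : ℝ)..t, (H s - 1)) := by
  set f : ℝ → ℂ := (Ioc (0 : ℝ) t).indicator H with hf
  have hfi : Integrable f := by
    refine IntegrableOn.integrable_indicator ?_ measurableSet_Ioc
    exact Integrable.of_bound hH.aestronglyMeasurable 1 (ae_of_all _ hH1)
  have happ : ∀ k : ℕ, ∃ g : ℝ → ℂ, Continuous g ∧
      eLpNorm (g - f) 1 volume ≤ ENNReal.ofReal (1 / ((k : ℝ) + 1)) := by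
    intro k
    obtain ⟨g, -, h1, h2, h3⟩ := hfi.exists_hasCompactSupport_integral_sub_le
      (show (0 : ℝ) < 1 / ((k : ℝ) + 1) by positivity)
    refine ⟨g, h2, ?_⟩
    rw [eLpNorm_sub_comm, eLpNorm_one_eq_lintegral_enorm]
    have := ofReal_integral_norm_eq_lintegral_enorm (hfi.sub h3)
    rw [← this]
    exact ENNReal.ofReal_le_ofReal h1
  choose g hgc hg using happ
  have hlim0 : Tendsto (fun k : ℕ => ENNReal.ofReal (1 / ((k : ℝ) + 1))) atTop (𝓝 0) := by
    simpa using ENNReal.tendsto_ofReal tendsto_one_div_add_atTop_nhds_zero_nat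
  have hL1 : Tendsto (fun k => eLpNorm (g k - f) 1 volume) atTop (𝓝 0) :=
    tendsto_of_tendsto_of_tendsto_of_le_of_le tendsto_const_nhds hlim0 (fun _ => zero_le) hg
  obtain ⟨ns, -, hns⟩ := (tendstoInMeasure_of_tendsto_eLpNorm one_ne_zero
    (fun k => (hgc k).aestronglyMeasurable) hfi.aestronglyMeasurable hL1).exists_seq_tendsto_ae
  set π : ℂ → ℂ := fun z => (((max 1 ‖z‖)⁻¹ : ℝ) : ℂ) * z with hπ
  have hπc : Continuous π := by
    refine Continuous.mul (Complex.continuous_ofReal.comp (Continuous.inv₀ (by fun_prop) ?_))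
      continuous_id
    exact fun z => (lt_max_of_lt_left one_pos).ne'
  have hπ1 : ∀ z, ‖π z‖ ≤ 1 := fun z => by
    have h0 : 0 < max 1 ‖z‖ := lt_max_of_lt_left one_pos
    rw [hπ, norm_mul, Complex.norm_real, Real.norm_eq_abs, abs_of_pos (inv_pos.2 h0),
      inv_mul_le_iff₀ h0, mul_one]
    exact le_max_right _ _
  have hπid : ∀ z, ‖z‖ ≤ 1 → π z = z := fun z hz => by simp [hπ, max_eq_left hz]
  have hlim : ∀ᵐ x : ℝ, x ∈ Ioc (0 : ℝ) t →
      Tendsto (fun k => π (g (ns k) x)) atTop (𝓝 (H x)) := by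
    filter_upwards [hns] with x hx hxt
    have h := (hπc.tendsto _).comp hx
    rwa [hf, indicator_of_mem hxt, hπid _ (hH1 x)] at h
  have hc : ∀ k, Continuous fun x => π (g (ns k) x) := fun k => hπc.comp (hgc _)
  refine tendsto_nhds_unique
    (hN.tendsto_integral_prod (fun k => (hc k).measurable) (fun k x => hπ1 _) hlim)
    ((tendsto_exp_intervalIntegral (fun k => (hc k).measurable) (fun k x => hπ1 _) hlim).congr
      fun k => ?_)
  exact (hN.integral_prod_of_continuous ht (hc k) fun x => hπ1 _).symm

end IsUnitPoissonProcess

namespace UrnScheme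

/-! ### Marked Poisson processes -/

variable {Ω : Type*} [MeasurableSpace Ω]

/-- A unit Poisson process with i.i.d. marks `ξ 0, ξ 1, …` which are independent of it. -/
structure IsMarkedPoisson (ξ : ℕ → Ω → ℕ) (N : ℝ≥0 → Ω → ℕ) (P : Measure Ω) : Prop where
  measurable_mark : ∀ n, Measurable (ξ n)
  indep_mark : iIndepFun ξ P
  ident_mark : ∀ n, IdentDistrib (ξ n) (ξ 0) P P
  poisson : IsUnitPoissonProcess N P
  indep : IndepFun (fun ω n => ξ n ω) (fun ω t => N t ω) P

/-- The number of arrival times in `u A`, among those in `(0, u]`. -/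
noncomputable def count (N : ℝ≥0 → Ω → ℕ) (u : ℝ≥0) (A : Set ℝ) (ω : Ω) : ℕ :=
  ∑ n ∈ Finset.range (N u ω), A.indicator (fun _ => 1) (tau N n ω / u)

/-- The number of arrival times in `t A`, among those in `(0, t]`, whose mark is `i`. -/
noncomputable def urnCount (ξ : ℕ → Ω → ℕ) (N : ℝ≥0 → Ω → ℕ) (t : ℝ≥0) (i : ℕ) (A : Set ℝ)
    (ω : Ω) : ℕ :=
  ∑ n ∈ Finset.range (N t ω), if ξ n ω = i then A.indicator (fun _ => 1) (tau N n ω / t) else 0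

/-- The exponent `∫ (e^{i φ} - 1)` of a compound Poisson characteristic function. -/
noncomputable def poissonExponent (φ : ℝ → ℝ) : ℂ :=
  ∫ s in (0 : ℝ)..1, (Complex.exp (φ s * Complex.I) - 1)

lemma intervalIntegrable_exp_sub_one {φ : ℝ → ℝ} (hφ : Measurable φ) (a b : ℝ) :
    IntervalIntegrable (fun s => Complex.exp (φ s * Complex.I) - 1) volume a b := by
  refine IntervalIntegrable.sub ?_ (by simp)
  refine (intervalIntegrable_const (c := (1 : ℝ))).mono_fun
    (by fun_prop : Measurable fun s => Complex.exp (φ s * Complex.I)).aestronglyMeasurable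
    (ae_of_all _ fun s => ?_)
  simp [Complex.norm_exp_ofReal_mul_I]

lemma measurable_natIndicator {A : Set ℝ} (hA : MeasurableSet A) :
    Measurable (A.indicator (fun _ => (1 : ℕ))) := measurable_const.indicator hA

lemma cast_natIndicator (A : Set ℝ) (x : ℝ) :
    ((A.indicator (fun _ => (1 : ℕ)) x : ℕ) : ℝ) = A.indicator (fun _ => (1 : ℝ)) x := by
  by_cases h : x ∈ A <;> simp [h]

namespace IsMarkedPoisson

variable {P : Measure Ω} [IsProbabilityMeasure P] {ξ : ℕ → Ω → ℕ} {N : ℝ≥0 → Ω → ℕ}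

omit [IsProbabilityMeasure P] in
lemma measurable_count (hN : IsUnitPoissonProcess N P) (u : ℝ≥0) {A : Set ℝ}
    (hA : MeasurableSet A) : Measurable (count N u A) := by
  unfold count
  exact measurable_sum_range (hN.measurable u) fun n =>
    (measurable_natIndicator hA).comp ((hN.measurable_tau n).div_const _)

variable (h : IsMarkedPoisson ξ N P)
include h

omit [IsProbabilityMeasure P] in
lemma measurable_urnCount (t : ℝ≥0) (i : ℕ) {A : Set ℝ} (hA : MeasurableSet A) :
    Measurable (urnCount ξ N t i A) := by
  unfold urnCount
  exact measurable_sum_range (h.poisson.measurable t) fun n =>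
    Measurable.ite (h.measurable_mark n (measurableSet_singleton i))
      ((measurable_natIndicator hA).comp ((h.poisson.measurable_tau n).div_const _)) measurable_const

/-- Averaging over the marks. -/
lemma integral_prod_mark (t : ℝ≥0) {φ : ℝ → ℕ → ℂ} (hφ : ∀ x, Measurable fun s => φ s x)
    (hφ1 : ∀ s x, ‖φ s x‖ ≤ 1) :
    ∫ ω, ∏ n ∈ Finset.range (N t ω), φ (tau N n ω) (ξ n ω) ∂P
      = ∫ ω, ∏ n ∈ Finset.range (N t ω), (∫ ω', φ (tau N n ω) (ξ 0 ω') ∂P) ∂P := by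
  have hφm : Measurable (fun y : ℝ × ℕ => φ y.1 y.2) := measurable_from_prod_countable_left hφ
  set Φ : (ℕ → ℕ) × (ℝ≥0 → ℕ) → ℂ :=
    fun y => ∏ n ∈ Finset.range (y.2 t), φ (pathArrival n y.2) (y.1 n) with hΦ
  have hΦm : Measurable Φ := by
    refine measurable_prod_range ((measurable_pi_apply t).comp measurable_snd) fun n => ?_
    exact hφm.comp (((measurable_pathArrival n).comp measurable_snd).prodMk
      ((measurable_pi_apply n).comp measurable_fst))
  have hX : Measurable fun ω n => ξ n ω := measurable_pi_iff.2 h.measurable_mark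
  have hNm : Measurable fun ω t => N t ω := measurable_pi_iff.2 h.poisson.measurable
  have : IsProbabilityMeasure (P.map fun ω n => ξ n ω) :=
    Measure.isProbabilityMeasure_map hX.aemeasurable
  have : IsProbabilityMeasure (P.map fun ω t => N t ω) :=
    Measure.isProbabilityMeasure_map hNm.aemeasurable
  have hlaw := (indepFun_iff_map_prod_eq_prod_map_map hX.aemeasurable hNm.aemeasurable).1 h.indep
  have hint : Integrable Φ ((P.map fun ω n => ξ n ω).prod (P.map fun ω t => N t ω)) :=
    Integrable.of_bound hΦm.aestronglyMeasurable 1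
      (ae_of_all _ fun y => norm_prod_le_one _ fun n => hφ1 _ _)
  have e1 : ∫ ω, ∏ n ∈ Finset.range (N t ω), φ (tau N n ω) (ξ n ω) ∂P
      = ∫ y, Φ y ∂(P.map fun ω => ((fun n => ξ n ω), fun t => N t ω)) := by
    rw [integral_map (hX.prodMk hNm).aemeasurable hΦm.aestronglyMeasurable]
    rfl
  rw [e1, hlaw, integral_prod_symm _ hint]
  have hsm : StronglyMeasurable fun f => ∫ x, Φ (x, f) ∂(P.map fun ω n => ξ n ω) :=
    (hΦm.comp measurable_swap).stronglyMeasurable.integral_prod_right'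
  rw [integral_map hNm.aemeasurable hsm.aestronglyMeasurable]
  refine integral_congr_ae (ae_of_all _ fun ω => ?_)
  have hm : Measurable fun x => Φ (x, fun t => N t ω) := hΦm.comp (measurable_id.prodMk
    measurable_const)
  simp only
  rw [integral_map hX.aemeasurable hm.aestronglyMeasurable]
  simp only [hΦ, Finset.prod_range]
  have hF : ∀ n, Measurable fun x => φ (pathArrival n fun t => N t ω) x :=
    fun n => measurable_from_nat
  have hind := ((h.indep_mark.precomp (Fin.val_injective (n := N t ω))).comp
    (fun n x => φ (pathArrival n fun t => N t ω) x) fun n => hF n).integral_fun_prod_eq_prod_integral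
      fun n => ((hF n).comp (h.measurable_mark n)).aestronglyMeasurable
  simp only [Function.comp_apply] at hind
  rw [hind]
  exact Finset.prod_congr rfl fun n _ => ((h.ident_mark n).comp (hF n)).integral_eq

/-- The characteristic functional of a marked Poisson process. -/
lemma integral_exp_sum_mark {t : ℝ≥0} (ht : 0 < t) {g : ℝ → ℕ → ℝ}
    (hg : ∀ x, Measurable fun s => g s x) :
    ∫ ω, Complex.exp ((∑ n ∈ Finset.range (N t ω), g (tau N n ω) (ξ n ω) : ℝ) * Complex.I) ∂P
      = Complex.exp (∫ s in (0 : ℝ)..t, ((∫ ω, Complex.exp (g s (ξ 0 ω) * Complex.I) ∂P) - 1)) := by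
  set φ : ℝ → ℕ → ℂ := fun s x => Complex.exp (g s x * Complex.I) with hφ
  have hφm : ∀ x, Measurable fun s => φ s x := fun x => by
    have := hg x
    simp only [hφ]; fun_prop
  have hφ1 : ∀ s x, ‖φ s x‖ ≤ 1 := fun s x => by rw [hφ, Complex.norm_exp_ofReal_mul_I]
  have hφm' : Measurable (fun y : ℝ × ℕ => φ y.1 y.2) := measurable_from_prod_countable_left hφm
  have hH : Measurable fun s => ∫ ω, φ s (ξ 0 ω) ∂P :=
    (hφm'.comp (measurable_fst.prodMk ((h.measurable_mark 0).comp
      measurable_snd))).stronglyMeasurable.integral_prod_right'.measurable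
  have hH1 : ∀ s, ‖∫ ω, φ s (ξ 0 ω) ∂P‖ ≤ 1 := fun s =>
    (norm_integral_le_of_norm_le_const (ae_of_all _ fun ω => hφ1 s (ξ 0 ω))).trans_eq (by simp)
  rw [← h.poisson.integral_prod ht hH hH1, ← h.integral_prod_mark t hφm hφ1]
  refine integral_congr_ae (ae_of_all _ fun ω => ?_)
  simp [hφ, Finset.sum_mul, Complex.exp_sum]

lemma integral_exp_sum_count {u : ℝ≥0} (hu : 0 < u) {φ : ℝ → ℝ} (hφ : Measurable φ) :
    ∫ ω, Complex.exp ((∑ n ∈ Finset.range (N u ω), φ (tau N n ω / u) : ℝ) * Complex.I) ∂P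
      = Complex.exp (u * poissonExponent φ) := by
  have hu' : (u : ℝ) ≠ 0 := (NNReal.coe_pos.2 hu).ne'
  rw [h.integral_exp_sum_mark hu (g := fun s _ => φ (s / u)) (fun x => by fun_prop)]
  congr 1
  simp only [integral_const, probReal_univ, one_smul]
  rw [intervalIntegral.integral_comp_div (fun s => Complex.exp (φ s * Complex.I) - 1) hu']
  simp [hu', poissonExponent]

lemma integral_exp_sum_urnCount {t : ℝ≥0} (ht : 0 < t) {κ : Type*} [Fintype κ] {lab : κ → ℕ}
    (hlab : Function.Injective lab) {φ : κ → ℝ → ℝ} (hφ : ∀ j, Measurable (φ j)) :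
    ∫ ω, Complex.exp ((∑ n ∈ Finset.range (N t ω), ∑ j,
        (if ξ n ω = lab j then φ j (tau N n ω / t) else 0) : ℝ) * Complex.I) ∂P
      = ∏ j, Complex.exp ((P.real {ω | ξ 0 ω = lab j} * t : ℝ) * poissonExponent (φ j)) := by
  have ht' : (t : ℝ) ≠ 0 := (NNReal.coe_pos.2 ht).ne'
  have hm : ∀ j, MeasurableSet {ω | ξ 0 ω = lab j} :=
    fun j => h.measurable_mark 0 (measurableSet_singleton _)
  rw [h.integral_exp_sum_mark ht
    (g := fun s x => ∑ j, if x = lab j then φ j (s / t) else 0) (fun x => by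
      refine Finset.measurable_fun_sum _ fun j _ => ?_
      have := hφ j
      split_ifs <;> fun_prop)]
  have hpt : ∀ (s : ℝ) (x : ℕ),
      Complex.exp ((∑ j, (if x = lab j then φ j (s / t) else 0) : ℝ) * Complex.I)
        = 1 + ∑ j, if x = lab j then Complex.exp (φ j (s / t) * Complex.I) - 1 else 0 := by
    intro s x
    by_cases hx : ∃ j, x = lab j
    · obtain ⟨j, rfl⟩ := hx
      have hj : ∀ j', lab j = lab j' ↔ j = j' := fun j' => hlab.eq_iff
      classical
      simp [hj]
    · push Not at hx
      simp [hx]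
  have hinner : ∀ s : ℝ, ((∫ ω, Complex.exp ((∑ j, (if ξ 0 ω = lab j then φ j (s / t) else 0) : ℝ)
      * Complex.I) ∂P) - 1)
      = ∑ j, (P.real {ω | ξ 0 ω = lab j} : ℂ) * (Complex.exp (φ j (s / t) * Complex.I) - 1) := by
    intro s
    simp_rw [hpt]
    have hint : ∀ j, Integrable (fun ω => if ξ 0 ω = lab j then
        Complex.exp (φ j (s / t) * Complex.I) - 1 else 0) P := fun j => by
      have := (integrable_const (μ := P) (Complex.exp (φ j (s / t) * Complex.I) - 1)).indicator
        (hm j)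
      exact this.congr (ae_of_all _ fun ω => by simp [indicator_apply])
    rw [integral_add (integrable_const _) (integrable_finsetSum _ fun j _ => hint j),
      integral_finsetSum _ fun j _ => hint j]
    simp only [integral_const, probReal_univ, one_smul, add_sub_cancel_left]
    refine Finset.sum_congr rfl fun j _ => ?_
    have := integral_indicator_const (μ := P) (Complex.exp (φ j (s / t) * Complex.I) - 1) (hm j)
    rw [Complex.real_smul] at this
    rw [← this]
    exact integral_congr_ae (ae_of_all _ fun ω => by simp [indicator_apply])
  simp_rw [hinner]
  rw [intervalIntegral.integral_finsetSum, Complex.exp_sum]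
  · refine Finset.prod_congr rfl fun j _ => ?_
    rw [intervalIntegral.integral_const_mul,
      intervalIntegral.integral_comp_div (fun s => Complex.exp (φ j s * Complex.I) - 1) ht']
    congr 1
    simp [ht', poissonExponent, mul_assoc]
  · intro j _
    exact (intervalIntegrable_exp_sub_one ((hφ j).comp (measurable_id.div_const _)) _ _).const_mul _

end IsMarkedPoisson

end UrnScheme

namespace UrnScheme

variable {Ω : Type*} [MeasurableSpace Ω]

/-- The length of `A ∩ (0, 1]`. -/
noncomputable def unitLength (A : Set ℝ) : ℝ := volume.real (Ioc 0 1 ∩ A)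

lemma unitLength_nonneg (A : Set ℝ) : 0 ≤ unitLength A := measureReal_nonneg

/-- The linear combination `∑ v_r 1_{A_r}`. -/
noncomputable def combo {ι : Type*} [Fintype ι] (A : ι → Set ℝ) (v : ι → ℝ) (s : ℝ) : ℝ :=
  ∑ r, v r * (A r).indicator (fun _ => 1) s

lemma measurable_combo {ι : Type*} [Fintype ι] {A : ι → Set ℝ} (hA : ∀ r, MeasurableSet (A r))
    (v : ι → ℝ) : Measurable (combo A v) :=
  Finset.measurable_fun_sum _ fun r _ => (measurable_const.indicator (hA r)).const_mul _

omit [MeasurableSpace Ω] in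
lemma sum_mul_count {ι : Type*} [Fintype ι] (N : ℝ≥0 → Ω → ℕ) (u : ℝ≥0) (A : ι → Set ℝ)
    (v : ι → ℝ) (ω : Ω) : ∑ r, v r * (count N u (A r) ω : ℝ)
      = ∑ n ∈ Finset.range (N u ω), combo A v (tau N n ω / u) := by
  simp only [count, combo, Nat.cast_sum, cast_natIndicator, Finset.mul_sum]
  exact Finset.sum_comm

omit [MeasurableSpace Ω] in
lemma sum_mul_urnCount {ι : Type*} [Fintype ι] (ξ : ℕ → Ω → ℕ) (N : ℝ≥0 → Ω → ℕ) (t : ℝ≥0)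
    (i : ℕ) (A : ι → Set ℝ) (v : ι → ℝ) (ω : Ω) : ∑ r, v r * (urnCount ξ N t i (A r) ω : ℝ)
      = ∑ n ∈ Finset.range (N t ω), if ξ n ω = i then combo A v (tau N n ω / t) else 0 := by
  simp only [urnCount, combo, Nat.cast_sum, Nat.cast_ite, cast_natIndicator, Finset.mul_sum,
    Nat.cast_zero]
  rw [Finset.sum_comm]
  refine Finset.sum_congr rfl fun n _ => ?_
  split_ifs <;> simp

lemma charFun_map_toLp {ι : Type*} [Fintype ι] {P : Measure Ω} {W : ι → Ω → ℝ}
    (hW : ∀ r, AEMeasurable (W r) P) (v : EuclideanSpace ℝ ι) :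
    charFun (P.map fun ω => (WithLp.toLp 2 fun r => W r ω : EuclideanSpace ℝ ι)) v
      = ∫ ω, Complex.exp ((∑ r, v r * W r ω : ℝ) * Complex.I) ∂P := by
  have hm : AEMeasurable (fun ω => (WithLp.toLp 2 fun r => W r ω : EuclideanSpace ℝ ι)) P :=
    (WithLp.measurable_toLp _ _).comp_aemeasurable (aemeasurable_pi_iff.2 hW)
  rw [charFun_apply, integral_map hm (by fun_prop)]
  simp [PiLp.inner_apply]

/-- The vector of the numbers of balls in urn `i` at times in `t A_r`. -/
noncomputable def urnVector (ξ : ℕ → Ω → ℕ) (N : ℝ≥0 → Ω → ℕ) (t : ℝ≥0) {ι : Type*}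
    (A : ι → Set ℝ) (i : ℕ) (ω : Ω) : EuclideanSpace ℝ ι :=
  WithLp.toLp 2 fun r => (urnCount ξ N t i (A r) ω : ℝ)

/-- The vector of the numbers of arrivals at times in `u A_r`. -/
noncomputable def countVector (N : ℝ≥0 → Ω → ℕ) (u : ℝ≥0) {ι : Type*}
    (A : ι → Set ℝ) (ω : Ω) : EuclideanSpace ℝ ι :=
  WithLp.toLp 2 fun r => (count N u (A r) ω : ℝ)

namespace IsMarkedPoisson

variable {P : Measure Ω} [IsProbabilityMeasure P] {ξ : ℕ → Ω → ℕ} {N : ℝ≥0 → Ω → ℕ}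

section

variable (h : IsMarkedPoisson ξ N P) {ι : Type*} [Fintype ι] {A : ι → Set ℝ}
  (hA : ∀ r, MeasurableSet (A r))
include h hA

omit [IsProbabilityMeasure P] [Fintype ι] in
lemma measurable_urnVector (t : ℝ≥0) (i : ℕ) : Measurable (urnVector ξ N t A i) :=
  (WithLp.measurable_toLp _ _).comp (measurable_pi_iff.2 fun r =>
    measurable_from_nat.comp (h.measurable_urnCount t i (hA r)))

omit [IsProbabilityMeasure P] [Fintype ι] in
lemma measurable_countVector (u : ℝ≥0) : Measurable (countVector N u A) :=
  (WithLp.measurable_toLp _ _).comp (measurable_pi_iff.2 fun r =>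
    measurable_from_nat.comp (measurable_count h.poisson u (hA r)))

lemma charFun_countVector {u : ℝ≥0} (hu : 0 < u) (v : EuclideanSpace ℝ ι) :
    charFun (P.map (countVector N u A)) v = Complex.exp (u * poissonExponent (combo A v)) := by
  rw [← h.integral_exp_sum_count hu (measurable_combo hA v)]
  refine (charFun_map_toLp (fun r => (measurable_from_nat.comp
    (measurable_count h.poisson u (hA r))).aemeasurable) v).trans ?_
  simp_rw [← sum_mul_count]
  rfl

lemma charFun_urnVector {t : ℝ≥0} (ht : 0 < t) (i : ℕ) (v : EuclideanSpace ℝ ι) :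
    charFun (P.map (urnVector ξ N t A i)) v
      = Complex.exp ((P.real {ω | ξ 0 ω = i} * t : ℝ) * poissonExponent (combo A v)) := by
  have e := h.integral_exp_sum_urnCount ht (κ := Unit) (lab := fun _ => i)
    (fun _ _ _ => rfl) (fun _ => measurable_combo hA v)
  simp only [Finset.univ_unique, Finset.sum_singleton, Finset.prod_singleton] at e
  rw [← e]
  refine (charFun_map_toLp (fun r => (measurable_from_nat.comp
    (h.measurable_urnCount t i (hA r))).aemeasurable) v).trans ?_
  simp_rw [← sum_mul_urnCount]
  rfl

/-- The counts in an urn chosen with probability `q`, at time `t`, have the same law as the counts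
of the whole process at time `q t`. -/
lemma map_urnVector {t u : ℝ≥0} (ht : 0 < t) (hu : 0 < u) {i : ℕ}
    (hi : P.real {ω | ξ 0 ω = i} * t = u) :
    P.map (urnVector ξ N t A i) = P.map (countVector N u A) := by
  have := Measure.isProbabilityMeasure_map (μ := P) (h.measurable_urnVector hA t i).aemeasurable
  have := Measure.isProbabilityMeasure_map (μ := P) (h.measurable_countVector hA u).aemeasurable
  refine Measure.ext_of_charFun (funext fun v => ?_)
  rw [h.charFun_urnVector hA ht, h.charFun_countVector hA hu, hi]

/-- The contents of different urns are independent. -/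
lemma iIndepFun_urnVector {t : ℝ≥0} (ht : 0 < t) {κ : Type*} [Fintype κ] {lab : κ → ℕ}
    (hlab : Function.Injective lab) :
    iIndepFun (fun j => urnVector ξ N t A (lab j)) P := by
  rw [iIndepFun_iff_charFun_pi fun j => (h.measurable_urnVector hA t (lab j)).aemeasurable]
  intro v
  simp_rw [h.charFun_urnVector hA ht]
  rw [← h.integral_exp_sum_urnCount ht hlab fun j => measurable_combo hA (v j)]
  have hm : Measurable fun ω => (WithLp.toLp 2 fun j => urnVector ξ N t A (lab j) ω :
      PiLp 2 fun _ : κ => EuclideanSpace ℝ ι) :=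
    (WithLp.measurable_toLp _ _).comp (measurable_pi_iff.2 fun j =>
      h.measurable_urnVector hA t (lab j))
  rw [charFun_apply, integral_map hm.aemeasurable (by fun_prop)]
  refine integral_congr_ae (ae_of_all _ fun ω => ?_)
  simp only
  congr 3
  rw [Finset.sum_comm]
  simp_rw [← sum_mul_urnCount]
  simp [PiLp.inner_apply, urnVector]

end

variable (h : IsMarkedPoisson ξ N P)
include h

omit h [IsProbabilityMeasure P] [MeasurableSpace Ω] in
lemma poissonExponent_combo {ι : Type*} [Fintype ι] {A : ι → Set ℝ}
    (hA : ∀ r, MeasurableSet (A r)) (hdisj : Pairwise fun r s => Disjoint (A r) (A s))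
    (v : ι → ℝ) : poissonExponent (combo A v)
      = ∑ r, (unitLength (A r) : ℂ) * (Complex.exp (v r * Complex.I) - 1) := by
  have hpt : ∀ s, Complex.exp (combo A v s * Complex.I) - 1
      = ∑ r, (A r).indicator (fun _ => Complex.exp (v r * Complex.I) - 1) s := by
    intro s
    by_cases hs : ∃ r, s ∈ A r
    · obtain ⟨r, hr⟩ := hs
      have hne : ∀ r', r' ≠ r → s ∉ A r' := fun r' hne hr' =>
        (Set.disjoint_left.1 (hdisj hne) hr') hr
      have e1 : combo A v s = v r := by
        rw [combo, Finset.sum_eq_single r (fun r' _ hn => by simp [hne r' hn]) (by simp)]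
        simp [hr]
      rw [e1, Finset.sum_eq_single r (fun r' _ hn => by simp [hne r' hn]) (by simp)]
      simp [hr]
    · push Not at hs
      simp [combo, hs]
  simp_rw [poissonExponent, hpt]
  rw [intervalIntegral.integral_finsetSum]
  · refine Finset.sum_congr rfl fun r _ => ?_
    rw [intervalIntegral.integral_of_le zero_le_one, setIntegral_indicator (hA r),
      setIntegral_const, Complex.real_smul, unitLength]
  · intro r _
    rw [intervalIntegrable_iff_integrableOn_Ioc_of_le zero_le_one]
    exact (integrableOn_const (by simp)).indicator (hA r)

/-- The law of a single count is Poisson. -/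
lemma map_count {u : ℝ≥0} (hu : 0 < u) {A : Set ℝ} (hA : MeasurableSet A) :
    P.map (fun ω => (count N u A ω : ℝ))
      = (poissonMeasure (u * (unitLength A).toNNReal)).map (fun n : ℕ => (n : ℝ)) := by
  have hm : Measurable fun ω => (count N u A ω : ℝ) :=
    measurable_from_nat.comp (measurable_count h.poisson u hA)
  have := Measure.isProbabilityMeasure_map (μ := P) hm.aemeasurable
  refine Measure.ext_of_charFun (funext fun x => ?_)
  have e := h.integral_exp_sum_count hu (measurable_combo (ι := Unit) (fun _ => hA) (fun _ => x))
  rw [poissonExponent_combo (fun _ => hA) (by intro r s hrs; exact absurd rfl hrs)] at e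
  simp_rw [← sum_mul_count] at e
  simp only [Finset.univ_unique, Finset.sum_singleton] at e
  have e2 := charFun_map_cast_poissonMeasure (u * (unitLength A).toNNReal) x
  rw [charFun_apply_real, integral_map hm.aemeasurable (by fun_prop)]
  refine Eq.trans ?_ (e.trans (Eq.trans ?_ e2.symm))
  · simp
  · rw [← mul_assoc]
    congr 2
    simp [Real.coe_toNNReal _ (unitLength_nonneg A)]

lemma real_count_eq {u : ℝ≥0} (hu : 0 < u) {A : Set ℝ} (hA : MeasurableSet A) (s : Set ℕ) :
    P.real (count N u A ⁻¹' s) = (poissonMeasure (u * (unitLength A).toNNReal)).real s := by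
  have e := h.map_count hu hA
  have hm := measurable_count h.poisson u hA
  have hc : Measurable fun n : ℕ => (n : ℝ) := measurable_from_nat
  have hs : MeasurableSet ((fun n : ℕ => (n : ℝ)) '' s) :=
    (s.to_countable.image _).measurableSet
  have hinj : ∀ s : Set ℕ, (fun n : ℕ => (n : ℝ)) ⁻¹' ((fun n : ℕ => (n : ℝ)) '' s) = s :=
    fun s => preimage_image_eq _ Nat.cast_injective
  have e1 := congrArg (fun μ : Measure ℝ => μ.real ((fun n : ℕ => (n : ℝ)) '' s)) e
  beta_reduce at e1
  rw [show (fun ω => (count N u A ω : ℝ)) = (fun n : ℕ => (n : ℝ)) ∘ count N u A from rfl,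
    map_measureReal_apply (hc.comp hm) hs, map_measureReal_apply hc hs, hinj,
    preimage_comp, hinj] at e1
  exact e1

/-- The counts in disjoint sets are independent. -/
lemma iIndepFun_count {u : ℝ≥0} (hu : 0 < u) {ι : Type*} [Fintype ι] {A : ι → Set ℝ}
    (hA : ∀ r, MeasurableSet (A r)) (hdisj : Pairwise fun r s => Disjoint (A r) (A s)) :
    iIndepFun (fun r ω => (count N u (A r) ω : ℝ)) P := by
  have hm : ∀ r, Measurable fun ω => (count N u (A r) ω : ℝ) := fun r =>
    measurable_from_nat.comp (measurable_count h.poisson u (hA r))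
  rw [iIndepFun_iff_charFun_pi fun r => (hm r).aemeasurable]
  intro v
  refine (h.charFun_countVector hA hu v).trans ?_
  rw [poissonExponent_combo hA hdisj, Finset.mul_sum, Complex.exp_sum]
  refine Finset.prod_congr rfl fun r _ => ?_
  rw [h.map_count hu (hA r)]
  refine Eq.trans ?_ (charFun_map_cast_poissonMeasure (u * (unitLength (A r)).toNNReal) (v r)).symm
  rw [← mul_assoc]
  congr 2
  simp [Real.coe_toNNReal _ (unitLength_nonneg (A r))]

end IsMarkedPoisson

end UrnScheme

namespace UrnScheme

lemma poissonWeight_zero_right (j : ℕ) : poissonWeight j 0 = if j = 0 then 1 else 0 := by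
  cases j <;> simp [poissonWeight]

variable {Ω : Type*} [MeasurableSpace Ω]

lemma covariance_indicator {P : Measure Ω} [IsProbabilityMeasure P] {E F : Set Ω}
    (hE : MeasurableSet E) (hF : MeasurableSet F) :
    cov[E.indicator (fun _ => (1 : ℝ)), F.indicator (fun _ => (1 : ℝ)); P]
      = P.real (E ∩ F) - P.real E * P.real F := by
  have hm : ∀ {G : Set Ω}, MeasurableSet G → MemLp (G.indicator (fun _ => (1 : ℝ))) 2 P :=
    fun hG => (memLp_const 1).indicator hG
  rw [covariance_eq_sub (hm hE) (hm hF)]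
  have e : E.indicator (fun _ => (1 : ℝ)) * F.indicator (fun _ => (1 : ℝ))
      = (E ∩ F).indicator (fun _ => (1 : ℝ)) := by
    funext ω
    by_cases h1 : ω ∈ E <;> by_cases h2 : ω ∈ F <;> simp [h1, h2]
  rw [e, integral_indicator_const _ hE, integral_indicator_const _ hF,
    integral_indicator_const _ (hE.inter hF)]
  simp

omit [MeasurableSpace Ω] in
lemma count_union (N : ℝ≥0 → Ω → ℕ) (u : ℝ≥0) {A B : Set ℝ} (hAB : Disjoint A B) (ω : Ω) :
    count N u (A ∪ B) ω = count N u A ω + count N u B ω := by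
  simp only [count, ← Finset.sum_add_distrib]
  refine Finset.sum_congr rfl fun n _ => ?_
  rw [indicator_union_of_disjoint hAB]

namespace IsMarkedPoisson

variable {P : Measure Ω} [IsProbabilityMeasure P] {ξ : ℕ → Ω → ℕ} {N : ℝ≥0 → Ω → ℕ}
  (h : IsMarkedPoisson ξ N P)
include h

lemma real_count_lt {u : ℝ≥0} (hu : 0 < u) {A : Set ℝ} (hA : MeasurableSet A) {k : ℕ}
    (hk : 1 ≤ k) : P.real {ω | count N u A ω < k}
      = ∑ j ∈ Finset.range k, poissonWeight j (unitLength A * u) := by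
  obtain ⟨k, rfl⟩ := Nat.exists_eq_add_of_le' hk
  have e : {ω | count N u A ω < k + 1} = count N u A ⁻¹' (Iic k) := by
    ext ω; simp
  rw [e, h.real_count_eq hu hA, poissonMeasure_real_Iic]
  simp [Real.coe_toNNReal _ (unitLength_nonneg A), mul_comm]

lemma real_forall_count_eq {u : ℝ≥0} (hu : 0 < u) {ι : Type*} [Fintype ι] {A : ι → Set ℝ}
    (hA : ∀ r, MeasurableSet (A r)) (hdisj : Pairwise fun r s => Disjoint (A r) (A s))
    (x : ι → ℕ) : P.real {ω | ∀ r, count N u (A r) ω = x r}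
      = ∏ r, poissonWeight (x r) (unitLength (A r) * u) := by
  have hind := (iIndepFun_iff_measure_inter_preimage_eq_mul.1 (h.iIndepFun_count hu hA hdisj))
    Finset.univ (sets := fun r => {(x r : ℝ)}) fun r _ => measurableSet_singleton _
  have e : {ω | ∀ r, count N u (A r) ω = x r}
      = ⋂ r ∈ Finset.univ, (fun ω => (count N u (A r) ω : ℝ)) ⁻¹' {(x r : ℝ)} := by
    ext ω; simp
  rw [e, measureReal_def, hind, ENNReal.toReal_prod]
  refine Finset.prod_congr rfl fun r _ => ?_
  have e2 : (fun ω => (count N u (A r) ω : ℝ)) ⁻¹' {(x r : ℝ)} = count N u (A r) ⁻¹' {x r} := by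
    ext ω; simp
  rw [e2, ← measureReal_def, h.real_count_eq hu (hA r), poissonMeasure_real_eq_poissonWeight]
  simp [Real.coe_toNNReal _ (unitLength_nonneg (A r)), mul_comm]

lemma exists_tame_real_inter {A B : Set ℝ} (hA : MeasurableSet A) (hB : MeasurableSet B)
    {k l : ℕ} (hk : 1 ≤ k) (hl : 1 ≤ l) : ∃ f : ℝ → ℝ, IsTame f ∧ f 0 = 1 ∧
      ∀ u : ℝ≥0, 0 < u → P.real ({ω | count N u A ω < k} ∩ {ω | count N u B ω < l}) = f u := by
  classical
  set D : Fin 3 → Set ℝ := ![A ∩ B, A \ B, B \ A] with hD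
  have hDm : ∀ j, MeasurableSet (D j) := by
    intro j
    fin_cases j
    exacts [hA.inter hB, hA.diff hB, hB.diff hA]
  have hdisj : Pairwise fun i j => Disjoint (D i) (D j) := by
    intro i j hij
    rw [Set.disjoint_left]
    intro x
    fin_cases i <;> fin_cases j <;> simp [D] at hij ⊢ <;> tauto
  have hcA : ∀ (u : ℝ≥0) ω, count N u A ω = count N u (D 0) ω + count N u (D 1) ω := by
    intro u ω
    rw [← count_union N u (hdisj (by decide : (0 : Fin 3) ≠ 1))]
    simp [D, inter_union_sdiff]
  have hcB : ∀ (u : ℝ≥0) ω, count N u B ω = count N u (D 0) ω + count N u (D 2) ω := by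
    intro u ω
    rw [← count_union N u (hdisj (by decide : (0 : Fin 3) ≠ 2))]
    simp [D, inter_comm A B, inter_union_sdiff]
  set S : Finset (Fin 3 → ℕ) := (Fintype.piFinset fun _ => Finset.range (k + l)).filter
    fun x => x 0 + x 1 < k ∧ x 0 + x 2 < l with hS
  have hmemS : ∀ x : Fin 3 → ℕ, x ∈ S ↔ x 0 + x 1 < k ∧ x 0 + x 2 < l := by
    intro x
    rw [hS, Finset.mem_filter, Fintype.mem_piFinset, and_iff_right_iff_imp]
    intro hx j
    rw [Finset.mem_range]
    fin_cases j <;> simp <;> omega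
  refine ⟨fun u => ∑ x ∈ S, poissonWeight (x 0) (unitLength (D 0) * u)
    * poissonWeight (x 1) (unitLength (D 1) * u) * poissonWeight (x 2) (unitLength (D 2) * u),
    ?_, ?_, fun u hu => ?_⟩
  · have hw : ∀ (x : Fin 3 → ℕ) j, IsTame fun u => poissonWeight (x j) (unitLength (D j) * u) :=
      fun x j => (isTame_poissonWeight _).comp_mul_left (unitLength_nonneg _)
    exact IsTame.sum S fun x _ => ((hw x 0).mul (hw x 1)).mul (hw x 2)
  · simp only [mul_zero, poissonWeight_zero_right]
    rw [Finset.sum_eq_single (fun _ => 0)]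
    · simp
    · intro x _ hx
      by_contra hne
      apply hx
      funext j
      fin_cases j <;> simp_all
    · intro hn
      exact absurd ((hmemS _).2 ⟨by simp; omega, by simp; omega⟩) hn
  · have e : {ω | count N u A ω < k} ∩ {ω | count N u B ω < l}
        = ⋃ x ∈ S, {ω | ∀ j, count N u (D j) ω = x j} := by
      ext ω
      simp only [mem_inter_iff, mem_ofPred_eq, mem_iUnion, exists_prop, hcA, hcB]
      constructor
      · exact fun hω => ⟨fun j => count N u (D j) ω, (hmemS _).2 hω, fun j => rfl⟩
      · rintro ⟨x, hx, hωx⟩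
        simpa only [hωx] using (hmemS x).1 hx
    have hmeas : ∀ x : Fin 3 → ℕ, MeasurableSet {ω | ∀ j, count N u (D j) ω = x j} := fun x => by
      have : {ω | ∀ j, count N u (D j) ω = x j} = ⋂ j, count N u (D j) ⁻¹' {x j} := by
        ext ω; simp
      rw [this]
      exact MeasurableSet.iInter fun j =>
        measurable_count h.poisson u (hDm j) (measurableSet_singleton _)
    rw [e, measureReal_biUnion_finset]
    · refine Finset.sum_congr rfl fun x _ => ?_
      rw [h.real_forall_count_eq hu hDm hdisj, Fin.prod_univ_three]
    · intro x _ y _ hxy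
      refine Set.disjoint_left.2 fun ω hx hy => hxy (funext fun j => ?_)
      exact (hx j).symm.trans (hy j)
    · exact fun x _ => hmeas x

/-- The covariance of the events that `u A` and `u B` contain few arrivals is a tame function
of `u` vanishing at `0`. -/
lemma exists_tame_covariance {A B : Set ℝ} (hA : MeasurableSet A) (hB : MeasurableSet B)
    {k l : ℕ} (hk : 1 ≤ k) (hl : 1 ≤ l) : ∃ f : ℝ → ℝ, IsTame f ∧ f 0 = 0 ∧
      ∀ u : ℝ≥0, 0 < u → cov[{ω | count N u A ω < k}.indicator (fun _ => (1 : ℝ)),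
        {ω | count N u B ω < l}.indicator (fun _ => (1 : ℝ)); P] = f u := by
  obtain ⟨f, hf, hf0, hfu⟩ := h.exists_tame_real_inter hA hB hk hl
  have hw : ∀ (C : Set ℝ) (n : ℕ),
      IsTame fun u => ∑ j ∈ Finset.range n, poissonWeight j (unitLength C * u) := fun C n =>
    IsTame.sum _ fun j _ => (isTame_poissonWeight j).comp_mul_left (unitLength_nonneg _)
  have hw0 : ∀ (C : Set ℝ) {n : ℕ}, 1 ≤ n →
      ∑ j ∈ Finset.range n, poissonWeight j (unitLength C * 0) = 1 := fun C n hn => by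
    simp only [mul_zero, poissonWeight_zero_right]
    rw [Finset.sum_ite_eq']
    simp; omega
  refine ⟨_, hf.sub ((hw A k).mul (hw B l)), ?_, fun u hu => ?_⟩
  · rw [hf0, hw0 A hk, hw0 B hl]
    norm_num
  · have hm : ∀ {C : Set ℝ}, MeasurableSet C → ∀ n, MeasurableSet {ω | count N u C ω < n} :=
      fun hC n => measurableSet_lt (measurable_count h.poisson u hC) measurable_const
    rw [covariance_indicator (hm hA k) (hm hB l), hfu u hu, h.real_count_lt hu hA hk,
      h.real_count_lt hu hB hl]

end IsMarkedPoisson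

end UrnScheme

namespace UrnScheme

/-! ### The statistics as functions of the counts -/

variable {Ω : Type*} {N : ℝ≥0 → Ω → ℕ} {ω : Ω}

lemma mem_dilate_iff {t : ℝ} (ht : 0 < t) {A : Set ℝ} {x : ℝ} : x ∈ dilate t A ↔ x / t ∈ A := by
  constructor
  · rintro ⟨a, ha, rfl⟩
    simpa [ht.ne'] using ha
  · exact fun hx => ⟨x / t, hx, by field_simp⟩

lemma IsCountingPath.tau_eq (h : IsCountingPath (fun s => N s ω)) (n : ℕ) :
    tau N n ω = arrivalTime N (n + 1) ω := h.pathArrival_eq n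

lemma IsCountingPath.arrivalTime_mem_dilate_iff (h : IsCountingPath (fun s => N s ω)) {u : ℝ≥0}
    (hu : 0 < u) {A : Set ℝ} (hA : A ⊆ Icc 0 1) (n : ℕ) :
    arrivalTime N (n + 1) ω ∈ dilate u A ↔ n < N u ω ∧ tau N n ω / u ∈ A := by
  have hu' : (0 : ℝ) < u := hu
  rw [mem_dilate_iff hu', ← h.tau_eq, iff_and_self]
  intro hx
  have := (hA hx).2
  rw [div_le_one hu'] at this
  exact (h.pathArrival_le_iff n u).1 this

lemma count_eq_card (u : ℝ≥0) (A : Set ℝ) [DecidablePred fun x => x ∈ A] :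
    count N u A ω = ((Finset.range (N u ω)).filter fun n => tau N n ω / u ∈ A).card := by
  rw [count, Finset.card_filter]
  refine Finset.sum_congr rfl fun n _ => ?_
  by_cases hx : tau N n ω / u ∈ A <;> simp [hx]

lemma urnCount_eq_card (ξ : ℕ → Ω → ℕ) (t : ℝ≥0) (i : ℕ) (A : Set ℝ)
    [DecidablePred fun x => x ∈ A] : urnCount ξ N t i A ω
      = ((Finset.range (N t ω)).filter fun n => ξ n ω = i ∧ tau N n ω / t ∈ A).card := by
  rw [urnCount, Finset.card_filter]
  refine Finset.sum_congr rfl fun n _ => ?_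
  by_cases hx : tau N n ω / t ∈ A <;> by_cases hi : ξ n ω = i <;> simp [hx, hi]

lemma IsCountingPath.numPoints_eq (h : IsCountingPath (fun s => N s ω)) {u : ℝ≥0}
    (hu : 0 < u) {A : Set ℝ} (hA : A ⊆ Icc 0 1) :
    numPoints N (dilate u A) ω = count N u A ω := by
  classical
  rw [count_eq_card, ← Set.encard_coe_eq_coe_finsetCard, numPoints]
  refine Eq.trans ?_ ((add_left_injective 1).encard_image _)
  congr 1
  ext n
  simp only [mem_ofPred_eq, mem_image, Finset.mem_coe, Finset.mem_filter, Finset.mem_range,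
    ← h.arrivalTime_mem_dilate_iff hu hA]
  constructor
  · rintro ⟨h1, h2⟩
    exact ⟨n - 1, by rwa [Nat.sub_add_cancel h1], Nat.sub_add_cancel h1⟩
  · rintro ⟨m, hm, rfl⟩
    exact ⟨by omega, hm⟩

lemma IsCountingPath.hitUrns_eq (h : IsCountingPath (fun s => N s ω))
    (hlt : ∀ n, arrivalTime N n ω < arrivalTime N (n + 1) ω) (X : ℕ → Ω → ℕ) {t : ℝ≥0}
    (ht : 0 < t) {A : Set ℝ} (hA : A ⊆ Icc 0 1) (l : ℕ) :
    hitUrns X N (dilate t A) l ω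
      = {i | 1 ≤ i ∧ l ≤ urnCount (fun n => X (n + 1)) N t i A ω} := by
  classical
  have hmono : StrictMono fun n => arrivalTime N n ω := strictMono_nat_of_lt_succ hlt
  ext i
  simp only [hitUrns, mem_ofPred_eq, urnCount_eq_card]
  refine and_congr_right fun _ => ?_
  set F := (Finset.range (N t ω)).filter fun n => X (n + 1) ω = i ∧ tau N n ω / t ∈ A with hF
  have hmem : ∀ n, n ∈ F ↔ arrivalTime N (n + 1) ω ∈ dilate t A ∧ X (n + 1) ω = i := by
    intro n
    rw [h.arrivalTime_mem_dilate_iff ht hA, hF, Finset.mem_filter, Finset.mem_range]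
    tauto
  constructor
  · rintro ⟨n, hn1, hn2, hn3⟩
    have hinj : Function.Injective fun j => n j - 1 := by
      intro i j hij
      have h1 := hn1 i
      have h2 := hn1 j
      simp only at hij
      exact hn2.injective (by rw [show n i = n j by omega])
    have := Finset.card_le_card_of_injOn (s := Finset.univ) (t := F) (fun j => n j - 1)
      (fun j _ => by
        rw [Finset.mem_coe, hmem, Nat.sub_add_cancel (hn1 j)]
        exact hn3 j) hinj.injOn
    simpa using this
  · intro hl
    obtain ⟨G, hGF, hG⟩ := Finset.exists_subset_card_eq hl
    refine ⟨fun j => G.orderEmbOfFin hG j + 1, fun j => Nat.le_add_left 1 _, fun i j hij => ?_, fun j => ?_⟩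
    · exact hmono (Nat.succ_lt_succ ((G.orderEmbOfFin hG).strictMono hij))
    · exact (hmem _).1 (hGF (G.orderEmbOfFin_mem hG j))

lemma IsCountingPath.hitUrns_eq_empty (h : IsCountingPath (fun s => N s ω)) (X : ℕ → Ω → ℕ)
    {t : ℝ} (ht : t ≤ 0) {A : Set ℝ} (hA : A ⊆ Icc 0 1) {l : ℕ} (hl : 1 ≤ l) :
    hitUrns X N (dilate t A) l ω = ∅ := by
  refine eq_empty_of_forall_notMem fun i hi => ?_
  obtain ⟨-, n, hn1, -, hn3⟩ := hi
  obtain ⟨a, ha, hax⟩ := (hn3 ⟨0, hl⟩).1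
  have h1 := h.pathArrival_pos (n ⟨0, hl⟩ - 1)
  rw [h.pathArrival_eq, Nat.sub_add_cancel (hn1 _), ← hax] at h1
  exact absurd h1 (not_lt.2 (mul_nonpos_of_nonpos_of_nonneg ht (hA ha).1))

/-- Urns which contain a ball carry one of the marks seen so far. -/
lemma setOf_le_urnCount_subset (ξ : ℕ → Ω → ℕ) (t : ℝ≥0) (A : Set ℝ) {l : ℕ} (hl : 1 ≤ l) :
    {i | 1 ≤ i ∧ l ≤ urnCount ξ N t i A ω}
      ⊆ ((Finset.range (N t ω)).image fun n => ξ n ω : Finset ℕ) := by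
  classical
  rintro i ⟨-, hi⟩
  rw [urnCount_eq_card] at hi
  obtain ⟨n, hn⟩ := Finset.card_pos.1 (hl.trans hi)
  rw [Finset.mem_filter] at hn
  exact Finset.mem_coe.2 (Finset.mem_image.2 ⟨n, hn.1, hn.2.1⟩)

/-- The number of urns with label at most `I` hit at least `l` times. -/
noncomputable def partialR (ξ : ℕ → Ω → ℕ) (N : ℝ≥0 → Ω → ℕ) (t : ℝ≥0) (A : Set ℝ) (l I : ℕ)
    (ω : Ω) : ℝ :=
  ∑ i ∈ Finset.range I, {ω | l ≤ urnCount ξ N t (i + 1) A ω}.indicator (fun _ => (1 : ℝ)) ω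

lemma partialR_eq_card (ξ : ℕ → Ω → ℕ) (t : ℝ≥0) (A : Set ℝ) (l I : ℕ) (ω : Ω) :
    partialR ξ N t A l I ω
      = ((Finset.range I).filter fun i => l ≤ urnCount ξ N t (i + 1) A ω).card := by
  rw [partialR, Finset.card_filter, Nat.cast_sum]
  refine Finset.sum_congr rfl fun i _ => ?_
  by_cases hi : l ≤ urnCount ξ N t (i + 1) A ω <;> simp [hi]

lemma partialR_le (ξ : ℕ → Ω → ℕ) (t : ℝ≥0) (A : Set ℝ) {l : ℕ} (hl : 1 ≤ l) (I : ℕ) (ω : Ω) :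
    partialR ξ N t A l I ω ≤ N t ω := by
  rw [partialR_eq_card, Nat.cast_le]
  have h1 : (((Finset.range I).filter fun i => l ≤ urnCount ξ N t (i + 1) A ω).map
      (addRightEmbedding 1)) ⊆ (Finset.range (N t ω)).image fun n => ξ n ω := by
    intro i hi
    rw [Finset.mem_map] at hi
    obtain ⟨j, hj, rfl⟩ := hi
    exact Finset.mem_coe.1 (setOf_le_urnCount_subset ξ t A hl
      ⟨by simp, (Finset.mem_filter.1 hj).2⟩)
  rw [← Finset.card_map (addRightEmbedding 1)]
  exact (Finset.card_le_card h1).trans (Finset.card_image_le.trans (by simp))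

lemma partialR_nonneg (ξ : ℕ → Ω → ℕ) (t : ℝ≥0) (A : Set ℝ) (l I : ℕ) (ω : Ω) :
    0 ≤ partialR ξ N t A l I ω :=
  Finset.sum_nonneg fun _ _ => indicator_nonneg (fun _ _ => zero_le_one) _

lemma eventually_partialR_eq (ξ : ℕ → Ω → ℕ) (t : ℝ≥0) (A : Set ℝ) {l : ℕ} (hl : 1 ≤ l) (ω : Ω) :
    ∀ᶠ I in atTop, partialR ξ N t A l I ω
      = ({i | 1 ≤ i ∧ l ≤ urnCount ξ N t i A ω}.ncard : ℝ) := by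
  have hsub := setOf_le_urnCount_subset (N := N) (ω := ω) ξ t A hl
  filter_upwards [eventually_gt_atTop (((Finset.range (N t ω)).image fun n => ξ n ω).sup id)]
    with I hI
  rw [partialR_eq_card, Nat.cast_inj, ← Finset.card_map (addRightEmbedding 1),
    ← Set.ncard_coe_finset]
  congr 1
  ext i
  simp only [Finset.coe_map, mem_image, Finset.mem_coe, Finset.mem_filter, Finset.mem_range,
    addRightEmbedding_apply, mem_ofPred_eq]
  constructor
  · rintro ⟨j, ⟨-, hj⟩, rfl⟩
    exact ⟨by omega, hj⟩
  · rintro ⟨hi1, hi2⟩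
    have hle : i ≤ ((Finset.range (N t ω)).image fun n => ξ n ω).sup id :=
      Finset.le_sup (f := id) (Finset.mem_coe.1 (hsub ⟨hi1, hi2⟩))
    exact ⟨i - 1, ⟨by omega, by rwa [Nat.sub_add_cancel hi1]⟩, Nat.sub_add_cancel hi1⟩

end UrnScheme

namespace UrnScheme

variable {Ω : Type*} [MeasurableSpace Ω]

/-- The linear combination `∑ v_r 1(k_r ≤ w_r)`. -/
noncomputable def threshold {ι : Type*} [Fintype ι] (k : ι → ℕ) (v : ι → ℝ)
    (w : EuclideanSpace ℝ ι) : ℝ :=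
  ∑ r, v r * (Ici (k r : ℝ)).indicator (fun _ => 1) (w r)

section threshold

variable {ι : Type*} [Fintype ι] (k : ι → ℕ) (v : ι → ℝ)

lemma measurable_threshold : Measurable (threshold k v) :=
  Finset.measurable_fun_sum _ fun r _ => ((measurable_const.indicator measurableSet_Ici).comp
    (by fun_prop : Measurable fun w : EuclideanSpace ℝ ι => w r)).const_mul _

lemma abs_threshold_le (w : EuclideanSpace ℝ ι) : |threshold k v w| ≤ ∑ r, |v r| := by
  refine (Finset.abs_sum_le_sum_abs _ _).trans (Finset.sum_le_sum fun r _ => ?_)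
  rw [abs_mul]
  refine mul_le_of_le_one_right (abs_nonneg _) ?_
  by_cases h : w r ∈ Ici (k r : ℝ) <;> simp only [h, indicator_of_mem, indicator_of_notMem,
    not_false_eq_true] <;> norm_num

lemma indicator_Ici_natCast (x y : ℕ) :
    (Ici (x : ℝ)).indicator (fun _ => (1 : ℝ)) (y : ℝ) = if x ≤ y then 1 else 0 := by
  simp [indicator_apply]

omit [MeasurableSpace Ω] in
lemma sum_threshold_urnVector (ξ : ℕ → Ω → ℕ) (N : ℝ≥0 → Ω → ℕ) (t : ℝ≥0) (A : ι → Set ℝ)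
    (I : ℕ) (ω : Ω) : ∑ i ∈ Finset.range I, threshold k v (urnVector ξ N t A (i + 1) ω)
      = ∑ r, v r * partialR ξ N t (A r) (k r) I ω := by
  simp only [threshold, urnVector, partialR, indicator_Ici_natCast, Finset.mul_sum]
  rw [Finset.sum_comm]
  simp [indicator_apply]

end threshold

namespace IsMarkedPoisson

variable {P : Measure Ω} [IsProbabilityMeasure P] {ξ : ℕ → Ω → ℕ} {N : ℝ≥0 → Ω → ℕ}
  (h : IsMarkedPoisson ξ N P) {ι : Type*} [Fintype ι] {A : ι → Set ℝ}
  (hA : ∀ r, MeasurableSet (A r))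
include h hA

lemma variance_threshold_countVector (k : ι → ℕ) (v : ι → ℝ) (u : ℝ≥0) :
    Var[fun ω => threshold k v (countVector N u A ω); P] = ∑ r, ∑ s, v r * v s *
      cov[{ω | count N u (A r) ω < k r}.indicator (fun _ => (1 : ℝ)),
        {ω | count N u (A s) ω < k s}.indicator (fun _ => (1 : ℝ)); P] := by
  set B : ι → Ω → ℝ := fun r => {ω | count N u (A r) ω < k r}.indicator (fun _ => (1 : ℝ)) with hB
  have hBm : ∀ r, MemLp (B r) 2 P := fun r =>
    (memLp_const 1).indicator (measurableSet_lt (measurable_count h.poisson u (hA r))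
      measurable_const)
  have hBi : ∀ r, Integrable (B r) P := fun r => (hBm r).integrable (by norm_num)
  have hCm : ∀ r, MemLp (fun ω => 1 - B r ω) 2 P := fun r => (memLp_const 1).sub (hBm r)
  have e : (fun ω => threshold k v (countVector N u A ω))
      = fun ω => ∑ r, v r * (1 - B r ω) := by
    funext ω
    simp only [threshold, countVector, indicator_Ici_natCast, hB]
    refine Finset.sum_congr rfl fun r _ => ?_
    by_cases hr : k r ≤ count N u (A r) ω
    · simp [hr]
    · simp [hr, not_le.1 hr]
  rw [e, variance_fun_sum fun r => (hCm r).const_mul (v r)]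
  refine Finset.sum_congr rfl fun r _ => Finset.sum_congr rfl fun s _ => ?_
  rw [covariance_const_mul_left, covariance_const_mul_right, covariance_const_sub_left (hBi r),
    covariance_const_sub_right (hBi s)]
  ring

lemma identDistrib_threshold (k : ι → ℕ) (v : ι → ℝ) {t u : ℝ≥0} (ht : 0 < t) (hu : 0 < u) {i : ℕ}
    (hi : P.real {ω | ξ 0 ω = i} * t = u) :
    IdentDistrib (fun ω => threshold k v (urnVector ξ N t A i ω))
      (fun ω => threshold k v (countVector N u A ω)) P P := by
  have hd : IdentDistrib (urnVector ξ N t A i) (countVector N u A) P P :=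
    ⟨(h.measurable_urnVector hA t i).aemeasurable, (h.measurable_countVector hA u).aemeasurable,
      h.map_urnVector hA ht hu hi⟩
  exact hd.comp (measurable_threshold k v)

/-- Central limit estimate for finitely many urns. -/
lemma norm_charFun_partial_sub_le (k : ι → ℕ) (v : ι → ℝ) {t : ℝ≥0} (ht : 0 < t) {σ : ℝ}
    (hσ : 0 < σ) (hΛ : 2 * (∑ r, |v r|) / σ ≤ 1) (I : ℕ) {D : ℕ → ℝ}
    (hD : ∀ i, Var[fun ω => threshold k v (urnVector ξ N t A (i + 1) ω); P] = D i) :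
    ‖∫ ω, Complex.exp ((∑ r, v r * ((partialR ξ N t (A r) (k r) I ω
        - ∫ ω', partialR ξ N t (A r) (k r) I ω' ∂P) / σ) : ℝ) * Complex.I) ∂P
      - Complex.exp ((-((∑ i ∈ Finset.range I, D i) / σ ^ 2) / 2 : ℝ) : ℂ)‖
      ≤ 2 * (2 * (∑ r, |v r|) / σ) * ((∑ i ∈ Finset.range I, D i) / σ ^ 2) := by
  set Λ := ∑ r, |v r|
  set T : ℕ → Ω → ℝ := fun i ω => threshold k v (urnVector ξ N t A (i + 1) ω) with hT
  have hTm : ∀ i, Measurable (T i) := fun i =>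
    (measurable_threshold k v).comp (h.measurable_urnVector hA t (i + 1))
  have hTb : ∀ i ω, |T i ω| ≤ Λ := fun i ω => abs_threshold_le k v _
  have hTi : ∀ i, Integrable (T i) P := fun i =>
    Integrable.of_bound (hTm i).aestronglyMeasurable Λ (ae_of_all _ (hTb i))
  have hET : ∀ i, |∫ ω, T i ω ∂P| ≤ Λ := fun i => by
    simpa using norm_integral_le_of_norm_le_const (μ := P) (f := T i) (C := Λ)
      (ae_of_all _ (hTb i))
  set Z : Fin I → Ω → ℝ := fun j ω => (T j ω - ∫ ω', T j ω' ∂P) / σ with hZ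
  have hind : iIndepFun Z P := by
    have := (h.iIndepFun_urnVector hA ht (κ := Fin I) (lab := fun j => (j : ℕ) + 1)
      (fun i j hij => Fin.ext (by simpa using hij))).comp
      (fun j w => (threshold k v w - ∫ ω', T j ω' ∂P) / σ)
      (fun j => ((measurable_threshold k v).sub_const _).div_const _)
    exact this
  have key := norm_integral_exp_sum_sub_exp_le (P := P) (Z := Z) hΛ
    (fun j => (((hTm j).sub_const _).div_const _).aemeasurable) hind (fun j => ae_of_all _ fun ω => by
      rw [hZ, abs_div, abs_of_pos hσ]
      gcongr
      have := abs_sub (T j ω) (∫ ω', T j ω' ∂P)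
      linarith [hTb j ω, hET j]) (fun j => by
      simp only [hZ]
      rw [integral_div, integral_sub (hTi j) (integrable_const _)]
      simp)
  have hsum : ∀ ω, ∑ j, Z j ω = ∑ r, v r * ((partialR ξ N t (A r) (k r) I ω
        - ∫ ω', partialR ξ N t (A r) (k r) I ω' ∂P) / σ) := by
    intro ω
    have hpm : ∀ r, Integrable (fun ω => partialR ξ N t (A r) (k r) I ω) P := fun r => by
      refine integrable_finsetSum _ fun i _ => (integrable_const _).indicator ?_
      exact measurableSet_le measurable_const (h.measurable_urnCount t (i + 1) (hA r))
    have e1 : ∑ i ∈ Finset.range I, ∫ ω', T i ω' ∂P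
        = ∑ r, v r * ∫ ω', partialR ξ N t (A r) (k r) I ω' ∂P := by
      rw [← integral_finsetSum _ fun i _ => hTi i]
      simp_rw [hT, sum_threshold_urnVector]
      rw [integral_finsetSum _ fun r _ => (hpm r).const_mul _]
      simp_rw [integral_const_mul]
    have e2 := sum_threshold_urnVector k v ξ N t A I ω
    simp only [hZ]
    rw [← Finset.sum_div, Finset.sum_sub_distrib, ← Finset.sum_range fun i => T i ω,
      ← Finset.sum_range fun i => ∫ ω', T i ω' ∂P, e1, e2, ← Finset.sum_sub_distrib,
      Finset.sum_div]
    exact Finset.sum_congr rfl fun r _ => by ring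
  have hvar : ∑ j, ∫ ω, Z j ω ^ 2 ∂P = (∑ i ∈ Finset.range I, D i) / σ ^ 2 := by
    rw [Finset.sum_div, Finset.sum_range]
    refine Finset.sum_congr rfl fun j _ => ?_
    rw [← hD, variance_eq_integral (hTm j).aemeasurable, ← integral_div]
    simp only [hZ, div_pow]
  rw [hvar] at key
  simp_rw [hsum] at key
  exact key

end IsMarkedPoisson

end UrnScheme

namespace UrnScheme

variable {Ω : Type*} [MeasurableSpace Ω]

lemma unitLength_Icc : unitLength (Icc 0 1) = 1 := by
  rw [unitLength, inter_eq_left.2 Ioc_subset_Icc_self]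
  simp

namespace IsMarkedPoisson

variable {P : Measure Ω} [IsProbabilityMeasure P] {X : ℕ → Ω → ℕ} {N : ℝ≥0 → Ω → ℕ}
  (h : IsMarkedPoisson (fun n => X (n + 1)) N P)
include h

omit [IsProbabilityMeasure P] in
lemma integrable_cast (t : ℝ≥0) : Integrable (fun ω => (N t ω : ℝ)) P := by
  have hm := h.poisson.measurable t
  refine ⟨(measurable_from_nat.comp hm).aestronglyMeasurable, ?_⟩
  have e : ∀ ω, ‖(N t ω : ℝ)‖ₑ = ((N t ω : ℕ) : ENNReal) := fun ω => by
    rw [Real.enorm_eq_ofReal (by positivity), ENNReal.ofReal_natCast]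
  rw [HasFiniteIntegral]
  simp_rw [e]
  have e2 : ∫⁻ ω, ((N t ω : ℕ) : ENNReal) ∂P = ∫⁻ k : ℕ, (k : ENNReal) ∂(P.map (N t)) :=
    (lintegral_map (f := fun k : ℕ => (k : ENNReal)) (by fun_prop) hm).symm
  rw [e2, (h.poisson.hasLaw t).map_eq, lintegral_cast_poissonMeasure]
  exact ENNReal.coe_lt_top

section

variable {t : ℝ≥0} {A : Set ℝ} {l : ℕ}

lemma ae_hitUrns_eq (ht : 0 < t) (hAs : A ⊆ Icc 0 1) : ∀ᵐ ω ∂P, hitUrns X N (dilate t A) l ω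
    = {i | 1 ≤ i ∧ l ≤ urnCount (fun n => X (n + 1)) N t i A ω} := by
  filter_upwards [h.poisson.ae_isCountingPath, h.poisson.ae_arrivalTime_lt] with ω h1 h2
  exact h1.hitUrns_eq h2 X ht hAs l

lemma ae_finite_hitUrns (ht : 0 < t) (hAs : A ⊆ Icc 0 1) (hl : 1 ≤ l) :
    ∀ᵐ ω ∂P, (hitUrns X N (dilate t A) l ω).Finite := by
  filter_upwards [h.ae_hitUrns_eq (l := l) ht hAs] with ω hω
  rw [hω]
  exact (Finset.finite_toSet _).subset (setOf_le_urnCount_subset _ t A hl)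

lemma ae_tendsto_partialR (ht : 0 < t) (hAs : A ⊆ Icc 0 1) (hl : 1 ≤ l) :
    ∀ᵐ ω ∂P, Tendsto (fun I => partialR (fun n => X (n + 1)) N t A l I ω) atTop
      (𝓝 (R X N t A l ω)) := by
  filter_upwards [h.ae_hitUrns_eq (l := l) ht hAs] with ω hω
  rw [R, hω]
  exact tendsto_const_nhds.congr' (EventuallyEq.symm (eventually_partialR_eq _ t A hl ω))

omit [IsProbabilityMeasure P] in
lemma measurable_partialR (hA : MeasurableSet A) (I : ℕ) :
    Measurable (partialR (fun n => X (n + 1)) N t A l I) :=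
  Finset.measurable_fun_sum _ fun i _ => measurable_const.indicator
    (measurableSet_le measurable_const (h.measurable_urnCount t (i + 1) hA))

lemma aemeasurable_R (ht : 0 < t) (hA : MeasurableSet A) (hAs : A ⊆ Icc 0 1) (hl : 1 ≤ l) :
    AEMeasurable (R X N t A l) P :=
  aemeasurable_of_tendsto_metrizable_ae atTop
    (fun I => (h.measurable_partialR hA I).aemeasurable) (h.ae_tendsto_partialR ht hAs hl)

omit h [IsProbabilityMeasure P] [MeasurableSpace Ω] in
lemma norm_partialR_le (hl : 1 ≤ l) (I : ℕ) (ω : Ω) :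
    ‖partialR (fun n => X (n + 1)) N t A l I ω‖ ≤ N t ω := by
  rw [Real.norm_eq_abs, abs_of_nonneg (partialR_nonneg _ t A l I ω)]
  exact partialR_le _ t A hl I ω

lemma integrable_R (ht : 0 < t) (hA : MeasurableSet A) (hAs : A ⊆ Icc 0 1) (hl : 1 ≤ l) :
    Integrable (R X N t A l) P := by
  refine (h.integrable_cast t).mono' (h.aemeasurable_R ht hA hAs hl).aestronglyMeasurable ?_
  filter_upwards [h.ae_tendsto_partialR ht hAs hl] with ω hω
  exact le_of_tendsto' hω.norm fun I => norm_partialR_le hl I ω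

lemma tendsto_integral_partialR (ht : 0 < t) (hA : MeasurableSet A) (hAs : A ⊆ Icc 0 1)
    (hl : 1 ≤ l) : Tendsto (fun I => ∫ ω, partialR (fun n => X (n + 1)) N t A l I ω ∂P) atTop
      (𝓝 (∫ ω, R X N t A l ω ∂P)) :=
  tendsto_integral_of_dominated_convergence _
    (fun I => (h.measurable_partialR hA I).aestronglyMeasurable) (h.integrable_cast t)
    (fun I => ae_of_all _ fun ω => norm_partialR_le hl I ω) (h.ae_tendsto_partialR ht hAs hl)

end

/-- The expected number of occupied urns is `∑ (1 - e^{-p_i t})`. -/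
lemma hasSum_M {t : ℝ≥0} (ht : 0 < t)
    (hpos : ∀ i, 0 < P.real {ω | X 1 ω = i + 1}) :
    HasSum (fun i => 1 - poissonWeight 0 (P.real {ω | X 1 ω = i + 1} * t)) (M X N P t) := by
  have hnn : ∀ i, 0 ≤ 1 - poissonWeight 0 (P.real {ω | X 1 ω = i + 1} * t) := fun i => by
    have := poissonWeight_le_one 0 (show 0 ≤ P.real {ω | X 1 ω = i + 1} * t by positivity)
    linarith
  rw [hasSum_iff_tendsto_nat_of_nonneg hnn, M]
  refine (h.tendsto_integral_partialR (l := 1) ht measurableSet_Icc Subset.rfl le_rfl).congr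
    fun I => ?_
  set A : Unit → Set ℝ := fun _ => Icc 0 1 with hAdef
  have hA : ∀ r, MeasurableSet (A r) := fun _ => measurableSet_Icc
  have e1 : ∀ ω, partialR (fun n => X (n + 1)) N t (Icc 0 1) 1 I ω = ∑ i ∈ Finset.range I,
      threshold (fun _ : Unit => 1) (fun _ => 1)
        (urnVector (fun n => X (n + 1)) N t A (i + 1) ω) := fun ω => by
    rw [sum_threshold_urnVector]; simp [A]
  simp_rw [e1]
  have hint : ∀ i, Integrable (fun ω => threshold (fun _ : Unit => 1) (fun _ => 1)
      (urnVector (fun n => X (n + 1)) N t A (i + 1) ω)) P := fun i =>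
    Integrable.of_bound ((measurable_threshold _ _).comp
      (h.measurable_urnVector hA t (i + 1))).aestronglyMeasurable _
      (ae_of_all _ fun ω => abs_threshold_le _ _ _)
  rw [integral_finsetSum _ fun i _ => hint i]
  refine Finset.sum_congr rfl fun i _ => ?_
  set u : ℝ≥0 := (P.real {ω | X 1 ω = i + 1}).toNNReal * t with hu
  have hu0 : 0 < u := mul_pos (Real.toNNReal_pos.2 (hpos i)) ht
  have hui : P.real {ω | X 1 ω = i + 1} * t = u := by
    rw [hu, NNReal.coe_mul, Real.coe_toNNReal _ (hpos i).le]
  rw [(h.identDistrib_threshold hA _ _ ht hu0 hui).integral_eq, hui]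
  have hset : MeasurableSet {ω | count N u (Icc 0 1) ω < 1} :=
    measurableSet_lt (measurable_count h.poisson u measurableSet_Icc) measurable_const
  have e2 : ∀ ω, threshold (fun _ : Unit => 1) (fun _ => 1) (countVector N u A ω)
      = {ω | count N u (Icc 0 1) ω < 1}ᶜ.indicator (fun _ => (1 : ℝ)) ω := fun ω => by
    simp only [threshold, countVector, Finset.univ_unique, Finset.sum_singleton, one_mul,
      indicator_Ici_natCast, A]
    simp [indicator_apply, Nat.one_le_iff_ne_zero]
  simp_rw [e2]
  rw [integral_indicator_const _ hset.compl, probReal_compl_eq_one_sub hset,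
    h.real_count_lt hu0 measurableSet_Icc le_rfl, unitLength_Icc]
  simp

/-- Central limit estimate for the Poissonized statistics. -/
lemma norm_charFun_sub_le {ι : Type*} [Fintype ι] {A : ι → Set ℝ}
    (hA : ∀ r, MeasurableSet (A r)) (hAs : ∀ r, A r ⊆ Icc 0 1) {k : ι → ℕ} (hk : ∀ r, 1 ≤ k r)
    (v : ι → ℝ) {t : ℝ≥0} (ht : 0 < t) {σ : ℝ} (hσ : 0 < σ) (hΛ : 2 * (∑ r, |v r|) / σ ≤ 1)
    {D : ℕ → ℝ} {S : ℝ} (hS : HasSum D S) (hD : ∀ i, Var[fun ω => threshold k v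
      (urnVector (fun n => X (n + 1)) N t A (i + 1) ω); P] = D i) :
    ‖∫ ω, Complex.exp ((∑ r, v r * ((R X N t (A r) (k r) ω
        - ∫ ω', R X N t (A r) (k r) ω' ∂P) / σ) : ℝ) * Complex.I) ∂P
      - Complex.exp ((-(S / σ ^ 2) / 2 : ℝ) : ℂ)‖
      ≤ 2 * (2 * (∑ r, |v r|) / σ) * (S / σ ^ 2) := by
  have hsum := hS.tendsto_sum_nat.div_const (σ ^ 2)
  refine le_of_tendsto_of_tendsto' (Tendsto.norm (Tendsto.sub ?_ ?_)) (hsum.const_mul _)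
    fun I => h.norm_charFun_partial_sub_le hA k v ht hσ hΛ I hD
  · refine tendsto_integral_of_dominated_convergence (fun _ => 1) (fun I => ?_)
      (integrable_const _) (fun I => ae_of_all _ fun ω => ?_) ?_
    · have := fun r => h.measurable_partialR (t := t) (l := k r) (hA r) I
      refine Measurable.aestronglyMeasurable ?_
      fun_prop
    · rw [Complex.norm_exp_ofReal_mul_I]
    · filter_upwards [ae_all_iff.2 fun r => h.ae_tendsto_partialR ht (hAs r) (hk r)] with ω hω
      refine (Complex.continuous_exp.tendsto _).comp (Tendsto.mul_const _
        ((Complex.continuous_ofReal.tendsto _).comp ?_))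
      exact tendsto_finsetSum _ fun r _ => (((hω r).sub
        (h.tendsto_integral_partialR ht (hA r) (hAs r) (hk r))).div_const σ).const_mul (v r)
  · exact (Complex.continuous_exp.tendsto _).comp ((Complex.continuous_ofReal.tendsto _).comp
      ((hsum.neg).div_const 2))

end IsMarkedPoisson

end UrnScheme

namespace UrnScheme

variable {Ω : Type*} [MeasurableSpace Ω]

lemma covariance_congr_ae {P : Measure Ω} {Z₁ Z₂ W₁ W₂ : Ω → ℝ} (h₁ : Z₁ =ᵐ[P] W₁)
    (h₂ : Z₂ =ᵐ[P] W₂) : cov[Z₁, Z₂; P] = cov[W₁, W₂; P] := by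
  rw [covariance, covariance, integral_congr_ae h₁, integral_congr_ae h₂]
  refine integral_congr_ae ?_
  filter_upwards [h₁, h₂] with ω e₁ e₂
  rw [e₁, e₂]

lemma Kstar_comm (N : ℝ≥0 → Ω → ℕ) (P : Measure Ω) (θ : ℝ) (A₁ : Set ℝ) (k₁ : ℕ) (A₂ : Set ℝ)
    (k₂ : ℕ) : Kstar N P θ A₁ k₁ A₂ k₂ = Kstar N P θ A₂ k₂ A₁ k₁ := by
  simp only [Kstar, covIntegrand, covariance_comm]

namespace IsMarkedPoisson

variable {P : Measure Ω} [IsProbabilityMeasure P] {X : ℕ → Ω → ℕ} {N : ℝ≥0 → Ω → ℕ}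

/-- The covariance integrand in terms of counts. -/
lemma covIntegrand_eq (hN : IsUnitPoissonProcess N P) (θ : ℝ)
    {A B : Set ℝ} (hA : A ⊆ Icc 0 1) (hB : B ⊆ Icc 0 1) (k l : ℕ) {u : ℝ≥0} (hu : 0 < u) :
    covIntegrand N P θ A k B l u
      = cov[{ω | count N u A ω < k}.indicator (fun _ => (1 : ℝ)),
        {ω | count N u B ω < l}.indicator (fun _ => (1 : ℝ)); P] * (θ * (u : ℝ) ^ (-θ - 1)) := by
  have e : ∀ {C : Set ℝ}, C ⊆ Icc 0 1 → ∀ n : ℕ,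
      {ω | numPoints N (dilate u C) ω < n}.indicator (fun _ => (1 : ℝ))
        =ᵐ[P] {ω | count N u C ω < n}.indicator (fun _ => (1 : ℝ)) := fun hC n => by
    filter_upwards [hN.ae_isCountingPath] with ω hω
    simp only [indicator_apply, mem_ofPred_eq, hω.numPoints_eq hu hC, Nat.cast_lt]
  rw [covIntegrand, covariance_congr_ae (e hA k) (e hB l)]

variable (h : IsMarkedPoisson (fun n => X (n + 1)) N P)
include h

lemma aemeasurable_Y {A : Set ℝ} (hA : MeasurableSet A) (hAs : A ⊆ Icc 0 1) {l : ℕ} (hl : 1 ≤ l)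
    (t : ℝ) : AEMeasurable (Y X N P t A l) P := by
  refine AEMeasurable.div_const (AEMeasurable.sub_const ?_ _) _
  rcases le_or_gt t 0 with ht | ht
  · refine (aemeasurable_const (b := (0 : ℝ))).congr ?_
    filter_upwards [h.poisson.ae_isCountingPath] with ω hω
    simp [R, hω.hitUrns_eq_empty X ht hAs hl]
  · lift t to ℝ≥0 using ht.le
    exact h.aemeasurable_R (NNReal.coe_pos.1 ht) hA hAs hl

variable {p : ℕ → ℝ} {θ : ℝ} (hp : ∀ i, 1 ≤ i → p i = P.real {ω | X 1 ω = i})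
  (hp_pos : ∀ i, 1 ≤ i → 0 < p i) (hp_anti : ∀ i, 1 ≤ i → p (i + 1) ≤ p i)
include hp

lemma summable_frequencies : Summable fun i => p (i + 1) := by
  have hX : Measurable (X 1) := h.measurable_mark 0
  have := Measure.isProbabilityMeasure_map (μ := P) hX.aemeasurable
  have e : ∀ i, p (i + 1) = (P.map (X 1)).real {i + 1} := fun i => by
    rw [hp (i + 1) (by omega), map_measureReal_apply hX (measurableSet_singleton _)]
    rfl
  simp_rw [e]
  refine summable_of_sum_le (c := 1) (fun _ => measureReal_nonneg) fun s => ?_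
  have := sum_measureReal_singleton (μ := P.map (X 1)) (s.map (addRightEmbedding 1))
  rw [Finset.sum_map] at this
  exact this.trans_le measureReal_le_one

include hp_pos hp_anti

lemma tendsto_M_div (hθ : θ ∈ Ioo (0 : ℝ) 1) (hreg : RegularityCondition p θ) :
    Tendsto (fun t => M X N P t / countingFunction p t) atTop (𝓝 (Real.Gamma (1 - θ))) := by
  have hsum := h.summable_frequencies hp
  have hq : ∀ i : ℕ, P.real {ω | X 1 ω = i + 1} = p (i + 1) := fun i => (hp (i + 1) (by omega)).symm
  have hlim := tendsto_tsum_tame_frequencies hp_anti hp_pos hsum hθ hreg isTame_one_sub_exp_neg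
    (by simp [poissonWeight])
  rw [integral_one_sub_exp_neg hθ] at hlim
  refine hlim.congr' ?_
  filter_upwards [eventually_gt_atTop 0] with t ht
  lift t to ℝ≥0 using ht.le
  have hM := h.hasSum_M (NNReal.coe_pos.1 ht) fun i => by rw [hq]; exact hp_pos _ (by omega)
  simp_rw [hq] at hM
  rw [hM.tsum_eq]

lemma tendsto_M_atTop (hθ : θ ∈ Ioo (0 : ℝ) 1) (hreg : RegularityCondition p θ) :
    Tendsto (fun t => M X N P t) atTop atTop := by
  have hα := tendsto_countingFunction hp_anti hp_pos (h.summable_frequencies hp)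
  have h1 := (h.tendsto_M_div hp hp_pos hp_anti hθ hreg).pos_mul_atTop
    (Real.Gamma_pos_of_pos (by linarith [hθ.2])) hα
  refine h1.congr' ?_
  filter_upwards [hα.eventually_gt_atTop 0] with t ht
  rw [div_mul_cancel₀ _ ht.ne']

/-- Convergence of the normalized sums of covariances. -/
lemma tendsto_tsum_div_M (hθ : θ ∈ Ioo (0 : ℝ) 1) (hreg : RegularityCondition p θ) {f : ℝ → ℝ}
    (hf : IsTame f) (hf0 : f 0 = 0) :
    Tendsto (fun t => (∑' i, f (p (i + 1) * t)) / M X N P t) atTop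
      (𝓝 (1 / Real.Gamma (1 - θ) * ∫ u in Ioi (0 : ℝ), f u * (θ * u ^ (-θ - 1)))) := by
  have hsum := h.summable_frequencies hp
  have hα := tendsto_countingFunction hp_anti hp_pos hsum
  have h1 := (tendsto_tsum_tame_frequencies hp_anti hp_pos hsum hθ hreg hf hf0).div
    (h.tendsto_M_div hp hp_pos hp_anti hθ hreg) (Real.Gamma_pos_of_pos (by linarith [hθ.2])).ne'
  rw [div_mul_eq_mul_div, one_mul]
  refine h1.congr' ?_
  filter_upwards [hα.eventually_gt_atTop 0] with t ht
  rw [Pi.div_apply, div_div_div_cancel_right₀ ht.ne']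

variable {ι : Type*} [Fintype ι] {A : ι → Set ℝ} {k : ι → ℕ}

/-- Convergence of the variances of linear combinations, and of the characteristic functions. -/
lemma tendsto_charFun_Y (hθ : θ ∈ Ioo (0 : ℝ) 1) (hreg : RegularityCondition p θ)
    (hA : ∀ r, MeasurableSet (A r)) (hAs : ∀ r, A r ⊆ Icc 0 1) (hk : ∀ r, 1 ≤ k r) (v : ι → ℝ) :
    0 ≤ ∑ r, ∑ s, v r * v s * Kstar N P θ (A r) (k r) (A s) (k s) ∧
    Tendsto (fun t => ∫ ω, Complex.exp ((∑ r, v r * Y X N P t (A r) (k r) ω : ℝ) * Complex.I) ∂P)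
      atTop (𝓝 (Complex.exp
        ((-(∑ r, ∑ s, v r * v s * Kstar N P θ (A r) (k r) (A s) (k s)) / 2 : ℝ) : ℂ))) := by
  have hsum := h.summable_frequencies hp
  choose f hf hf0 hfu using fun r s => h.exists_tame_covariance (hA r) (hA s) (hk r) (hk s)
  have hK : ∀ r s, Kstar N P θ (A r) (k r) (A s) (k s)
      = 1 / Real.Gamma (1 - θ) * ∫ u in Ioi (0 : ℝ), f r s u * (θ * u ^ (-θ - 1)) := fun r s => by
    rw [Kstar]
    congr 1
    refine setIntegral_congr_fun measurableSet_Ioi fun u hu => ?_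
    have hu0 : 0 < u := hu
    lift u to ℝ≥0 using hu0.le
    rw [covIntegrand_eq h.poisson θ (hAs r) (hAs s) _ _ (NNReal.coe_pos.1 hu0),
      hfu r s u (NNReal.coe_pos.1 hu0)]
  set D : ℝ → ℝ := fun u => ∑ r, ∑ s, v r * v s * f r s u with hDdef
  have hD : IsTame D := IsTame.sum _ fun r _ => IsTame.sum _ fun s _ =>
    (IsTame.const (v r * v s)).mul (hf r s)
  have hD0 : D 0 = 0 := by simp [hDdef, hf0]
  have hlim := h.tendsto_tsum_div_M hp hp_pos hp_anti hθ hreg hD hD0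
  set V := ∑ r, ∑ s, v r * v s * Kstar N P θ (A r) (k r) (A s) (k s) with hV
  have hVeq : 1 / Real.Gamma (1 - θ) * ∫ u in Ioi (0 : ℝ), D u * (θ * u ^ (-θ - 1)) = V := by
    have hi : ∀ r s, Integrable (fun u => v r * v s * (f r s u * (θ * u ^ (-θ - 1))))
        (volume.restrict (Ioi 0)) := fun r s =>
      ((hf r s).integrableOn_mul_rpow (hf0 r s) hθ).const_mul _
    have e : ∀ u, D u * (θ * u ^ (-θ - 1))
        = ∑ r, ∑ s, v r * v s * (f r s u * (θ * u ^ (-θ - 1))) := fun u => by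
      simp only [hDdef, Finset.sum_mul, mul_assoc]
    simp_rw [e]
    rw [integral_finsetSum _ fun r _ => integrable_finsetSum _ fun s _ => hi r s, Finset.mul_sum]
    refine Finset.sum_congr rfl fun r _ => ?_
    rw [integral_finsetSum _ fun s _ => hi r s, Finset.mul_sum]
    refine Finset.sum_congr rfl fun s _ => ?_
    rw [integral_const_mul, hK]
    ring
  rw [hVeq] at hlim
  have hvar : ∀ t : ℝ≥0, 0 < t → ∀ i, Var[fun ω => threshold k v
      (urnVector (fun n => X (n + 1)) N t A (i + 1) ω); P] = D (p (i + 1) * t) := by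
    intro t ht i
    have hpi := hp_pos (i + 1) (by omega)
    set u : ℝ≥0 := (p (i + 1)).toNNReal * t with hu
    have hu0 : 0 < u := mul_pos (Real.toNNReal_pos.2 hpi) ht
    have hui : p (i + 1) * t = u := by
      rw [hu, NNReal.coe_mul, Real.coe_toNNReal _ hpi.le]
    rw [(h.identDistrib_threshold hA k v ht hu0 (by
      rw [← hui, hp (i + 1) (by omega)])).variance_eq,
      h.variance_threshold_countVector hA k v u, hui]
    exact Finset.sum_congr rfl fun r _ => Finset.sum_congr rfl fun s _ => by rw [hfu r s u hu0]
  have hMtop := h.tendsto_M_atTop hp hp_pos hp_anti hθ hreg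
  refine ⟨?_, ?_⟩
  · refine ge_of_tendsto hlim ?_
    filter_upwards [hMtop.eventually_gt_atTop 0, eventually_gt_atTop 0] with t hM ht
    lift t to ℝ≥0 using ht.le
    refine div_nonneg (tsum_nonneg fun i => ?_) hM.le
    rw [← hvar t (NNReal.coe_pos.1 ht) i]
    exact variance_nonneg _ _
  have hsqrt : Tendsto (fun t => √(M X N P t)) atTop atTop := Real.tendsto_sqrt_atTop.comp hMtop
  have hε : Tendsto (fun t => 2 * (∑ r, |v r|) / √(M X N P t)) atTop (𝓝 0) :=
    hsqrt.const_div_atTop _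
  have hbound : Tendsto (fun t => 2 * (2 * (∑ r, |v r|) / √(M X N P t))
      * ((∑' i, D (p (i + 1) * t)) / M X N P t)) atTop (𝓝 0) := by
    simpa using (hε.const_mul 2).mul hlim
  have hgauss : Tendsto (fun t =>
      Complex.exp ((-((∑' i, D (p (i + 1) * t)) / M X N P t) / 2 : ℝ) : ℂ)) atTop
      (𝓝 (Complex.exp ((-V / 2 : ℝ) : ℂ))) :=
    (Complex.continuous_exp.tendsto _).comp ((Complex.continuous_ofReal.tendsto _).comp
      (hlim.neg.div_const 2))
  refine hgauss.congr_dist (squeeze_zero' (Eventually.of_forall fun _ => dist_nonneg) ?_ hbound)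
  filter_upwards [hMtop.eventually_gt_atTop 0, eventually_gt_atTop 0,
    hε.eventually_le_const one_pos] with t hM ht hle
  lift t to ℝ≥0 using ht.le
  have hs : HasSum (fun i => D (p (i + 1) * t)) (∑' i, D (p (i + 1) * t)) :=
    (hasSum_tame_frequencies hp_anti hp_pos hsum hD hD0 ht).summable.hasSum
  have := h.norm_charFun_sub_le hA hAs hk v (NNReal.coe_pos.1 ht) (Real.sqrt_pos.2 hM) hle hs
    (hvar t (NNReal.coe_pos.1 ht))
  rw [Real.sq_sqrt hM.le] at this
  rw [dist_comm, dist_eq_norm]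
  exact this

end IsMarkedPoisson

end UrnScheme

theorem mainTheorem2 {Ω : Type*} [MeasurableSpace Ω] (P : Measure Ω) [IsProbabilityMeasure P]
    (X : ℕ → Ω → ℕ) (N : ℝ≥0 → Ω → ℕ) (p : ℕ → ℝ) (θ : ℝ)
    -- the urn labels `X 1, X 2, …` are i.i.d. positive integers with probabilities `p 1 ≥ p 2 ≥ …`
    (hX_meas : ∀ n, 1 ≤ n → Measurable (X n))
    (hX_pos : ∀ n, 1 ≤ n → ∀ᵐ ω ∂P, 1 ≤ X n ω)
    (hX_indep : iIndepFun (fun n : {n : ℕ // 1 ≤ n} => X n) P)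
    (hX_ident : ∀ n, 1 ≤ n → IdentDistrib (X n) (X 1) P P)
    (hp : ∀ i, 1 ≤ i → p i = P.real {ω | X 1 ω = i})
    (hp_pos : ∀ i, 1 ≤ i → 0 < p i)
    (hp_anti : ∀ i, 1 ≤ i → p (i + 1) ≤ p i)
    -- `N` is a unit-rate Poisson process independent of the labels
    (hN : IsUnitPoissonProcess N P)
    (hXN : IndepFun (fun ω (n : {n : ℕ // 1 ≤ n}) => X n ω) (fun ω t => N t ω) P)
    (hθ : θ ∈ Ioo (0 : ℝ) 1)
    (hreg : UrnScheme.RegularityCondition p θ)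
    (m : ℕ) (A : Fin m → Set ℝ) (k : Fin m → ℕ)
    (hA_meas : ∀ r, MeasurableSet (A r)) (hA_sub : ∀ r, A r ⊆ Icc 0 1) (hk : ∀ r, 1 ≤ k r) :
    -- the expectations and the integrals in the statement exist
    (∀ t : ℝ, 0 < t → ∀ B : Set ℝ, MeasurableSet B → B ⊆ Icc 0 1 → ∀ l : ℕ, 1 ≤ l →
      (∀ᵐ ω ∂P, (UrnScheme.hitUrns X N (UrnScheme.dilate t B) l ω).Finite) ∧
      Integrable (UrnScheme.R X N t B l) P) ∧
    (∀ r s, IntegrableOn (UrnScheme.covIntegrand N P θ (A r) (k r) (A s) (k s)) (Ioi 0)) ∧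
    ∃ (γ : Measure (EuclideanSpace ℝ (Fin m))) (_ : IsGaussian γ),
      (∀ r, ∫ y, y r ∂γ = 0) ∧
      (∀ r s, cov[fun y => y r, fun y => y s; γ] =
        UrnScheme.Kstar N P θ (A r) (k r) (A s) (k s)) ∧
      TendstoInDistribution
        (fun (t : ℝ) ω => (WithLp.toLp 2 fun r => UrnScheme.Y X N P t (A r) (k r) ω :
          EuclideanSpace ℝ (Fin m)))
        atTop id (fun _ => P) γ := by
  have h : UrnScheme.IsMarkedPoisson (fun n => X (n + 1)) N P :=
    { measurable_mark := fun n => hX_meas (n + 1) (by omega)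
      indep_mark := hX_indep.precomp (g := fun n : ℕ => ⟨n + 1, by omega⟩)
        fun a b hab => Nat.succ_injective (congrArg Subtype.val hab)
      ident_mark := fun n => hX_ident (n + 1) (by omega)
      poisson := hN
      indep := hXN.comp (φ := fun x n => x ⟨n + 1, by omega⟩) (ψ := id)
        (measurable_pi_lambda _ fun n => measurable_pi_apply _) measurable_id }
  refine ⟨fun t ht B hB hBs l hl => ?_, fun r s => ?_, ?_⟩
  · lift t to ℝ≥0 using ht.le
    exact ⟨h.ae_finite_hitUrns (NNReal.coe_pos.1 ht) hBs hl,
      h.integrable_R (NNReal.coe_pos.1 ht) hB hBs hl⟩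
  · obtain ⟨f, hf, hf0, hfu⟩ := h.exists_tame_covariance (hA_meas r) (hA_meas s) (hk r) (hk s)
    refine (hf.integrableOn_mul_rpow hf0 hθ).congr_fun (fun u hu => ?_) measurableSet_Ioi
    have hu0 : 0 < u := hu
    lift u to ℝ≥0 using hu0.le
    rw [UrnScheme.IsMarkedPoisson.covIntegrand_eq h.poisson θ (hA_sub r) (hA_sub s) _ _
      (NNReal.coe_pos.1 hu0), hfu u (NNReal.coe_pos.1 hu0)]
  set K : Matrix (Fin m) (Fin m) ℝ :=
    Matrix.of fun r s => UrnScheme.Kstar N P θ (A r) (k r) (A s) (k s) with hKdef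
  have hlim := h.tendsto_charFun_Y hp hp_pos hp_anti hθ hreg hA_meas hA_sub hk
  have hquad : ∀ v : Fin m → ℝ, v ⬝ᵥ K.mulVec v
      = ∑ r, ∑ s, v r * v s * UrnScheme.Kstar N P θ (A r) (k r) (A s) (k s) := fun v => by
    simp only [dotProduct, Matrix.mulVec, Finset.mul_sum, hKdef, Matrix.of_apply]
    exact Finset.sum_congr rfl fun r _ => Finset.sum_congr rfl fun s _ => by ring
  have hK : K.PosSemidef := Matrix.PosSemidef.of_dotProduct_mulVec_nonneg
    (Matrix.IsHermitian.ext fun r s => UrnScheme.Kstar_comm ..) fun v => by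
      rw [star_trivial, hquad]
      exact (hlim v).1
  have hY : ∀ t r, AEMeasurable (UrnScheme.Y X N P t (A r) (k r)) P := fun t r =>
    h.aemeasurable_Y (hA_meas r) (hA_sub r) (hk r) t
  refine ⟨multivariateGaussian 0 K, inferInstance, fun r => ?_,
    fun r s => covariance_eval_multivariateGaussian hK r s, ?_⟩
  · have := ContinuousLinearMap.integral_comp_id_comm
      (IsGaussian.integrable_id (μ := multivariateGaussian 0 K))
      (EuclideanSpace.proj (𝕜 := ℝ) r)
    simpa using this
  · refine ⟨fun t => (WithLp.measurable_toLp _ _).comp_aemeasurable (aemeasurable_pi_iff.2 (hY t)),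
      aemeasurable_id, ?_⟩
    refine tendsto_of_seq_tendsto fun u hu => ?_
    refine ProbabilityMeasure.tendsto_iff_tendsto_charFun.2 fun v => ?_
    simp only [ProbabilityMeasure.coe_mk, Measure.map_id, charFun_multivariateGaussian hK]
    convert (hlim v).2.comp hu using 2
    · exact UrnScheme.charFun_map_toLp (hY _) v
    · rw [← hquad]
      simp [neg_div]
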